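/- Let $\Gamma$ be a countable infinite connected graph with symmetric weights $\mu_{x,y}=\mu_{y,x}$, positive exactly on the edges $x\sim y$, and such that $\mu(x)=\sum_{y\sim x}\mu_{x,y}<\infty$ for every vertex $x$. Put $\mu(A)=\sum_{y\in A}\mu(y)$ for $A\subset\Gamma$, and $P(x,y)=\mu_{x,y}/\mu(x)$. Let $(X_n)$ be the Markov chain (random walk) with transition probabilities $P(x,y)$, let $Pf(x)=\sum_y P(x,y)f(y)$ and $\Delta=P-I$. Let $d$ be the graph distance, $B(x,R)=\{y: d(x,y)<R\}$ for real $R>0$, $V(x,R)=\mu(B(x,R))$ and $v(x,r,R)=V(x,R)-V(x,r)$. Let $E(x,R)=\mathbb E(T_{B(x,R)}\mid X_0=x)$, where $T_A=\min\{k: X_k\notin A\}$ is the exit time from $A$. For disjoint $A,B\subset\Gamma$ the resistance is $$\rho(A,B)=\Bigl(\inf\bigl\{(-\Delta f,f)_\mu : f \text{ finitely supported},\ f|_A=1,\ f|_B=0\bigr\}\Bigr)^{-1},\qquad (f,g)_\mu=\sum_x f(x)g(x)\mu(x),$$ and $\rho(x,r,R)=\rho(B(x,r),\Gamma\setminus B(x,R))$.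 Suppose that the following conditions hold. * $(p_0)$: there is $p_0>0$ such that $\mu_{x,y}/\mu(x)\ge p_0$ for all $x\sim y$. * $(VD)$: there is $D_V>0$ such that $V(x,2R)\le D_V V(x,R)$ for all $x\in\Gamma$ and $R>0$. * $(H)$: there is $H>1$ such that for all $x\in\Gamma$, $R>0$ and every non-negative function $u$ that is harmonic in $B(x,2R)$ (that is, $Pu=u$ on $B(x,2R)$), $\max_{B(x,R)}u\le H\min_{B(x,R)}u$. * Anti-doubling of $\rho v$: there is $A>1$ such that for all $x\in\Gamma$ and $R>0$, $$\rho(x,AR,2AR)\,v(x,AR,2AR)\ \ge\ 2\,\rho(x,R,2R)\,v(x,R,2R).$$ Then $E(x,2R)\simeq\rho(x,R,2R)\,v(x,R,2R)$: there is a constant $C>1$ such that for all $x\in\Gamma$ and all real $R>\tfrac12$, $$C^{-1}E(x,2R)\ \le\ \rho(x,R,2R)\,v(x,R,2R)\ \le\ C\,E(x,2R).$$ -/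

import Mathlib

open MeasureTheory ProbabilityTheory
open scoped ENNReal

/-- The simple graph that joins two distinct points `x`, `y` when the symmetric weight `w x y` is
positive. It carries the shortest-path distance (loops play no role for the distance). -/
def weightAdjacency {V : Type*} (w : V → V → ℝ) : SimpleGraph V :=
  SimpleGraph.fromRel fun x y => 0 < w x y

/-- A connected weighted graph `(Γ, μ)` on the vertex set `V`: the edges `x ∼ y` are the pairs with
`0 < w x y`, and `w x y = w y x` is the weight `μ_{x,y}` of the edge. The vertex weights
`μ(x) = ∑_y μ_{x,y}` are finite. A positive diagonal weight is a loop. -/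
structure WeightedGraph (V : Type*) where
  w : V → V → ℝ
  symm : ∀ x y, w x y = w y x
  nonneg : ∀ x y, 0 ≤ w x y
  summable : ∀ x, Summable (w x)
  connected : (weightAdjacency w).Connected

namespace WeightedGraph

variable {V : Type*} (Γ : WeightedGraph V)

/-- `x ∼ y`. -/
def Edge (x y : V) : Prop := 0 < Γ.w x y

/-- The shortest-path distance `d(x, y)`. -/
noncomputable def dist (x y : V) : ℕ := (weightAdjacency Γ.w).dist x y

/-- The vertex weight `μ(x) = ∑_{y ∼ x} μ_{x,y}`. -/
noncomputable def mu (x : V) : ℝ := ∑' y, Γ.w x y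

/-- The measure `μ(A) = ∑_{y ∈ A} μ(y)` of a vertex set. -/
noncomputable def vol (A : Set V) : ℝ≥0∞ := ∑' y : A, ENNReal.ofReal (Γ.mu y)

/-- The open ball `B(x, R) = {y : d(x, y) < R}`. -/
def ball (x : V) (R : ℝ) : Set V := {y | (Γ.dist x y : ℝ) < R}

/-- `V(x, R) = μ(B(x, R))`. -/
noncomputable def ballVol (x : V) (R : ℝ) : ℝ≥0∞ := Γ.vol (Γ.ball x R)

/-- `v(x, r, R) = V(x, R) - V(x, r)`. -/
noncomputable def annulusVol (x : V) (r R : ℝ) : ℝ≥0∞ := Γ.ballVol x R - Γ.ballVol x r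

/-- The transition probability `P(x, y) = μ_{x,y} / μ(x)`. -/
noncomputable def P (x y : V) : ℝ := Γ.w x y / Γ.mu x

/-- The Markov operator `P f (x) = ∑_y P(x, y) f(y)`. -/
noncomputable def markov (f : V → ℝ) (x : V) : ℝ := ∑' y, Γ.P x y * f y

/-- The Laplace operator `Δ = P - I`. -/
noncomputable def laplace (f : V → ℝ) (x : V) : ℝ := Γ.markov f x - f x

/-- The inner product `(f, g) = ∑_x f(x) g(x) μ(x)`, used when `f` or `g` has finite support. -/
noncomputable def innerMu (f g : V → ℝ) : ℝ := ∑' x, f x * g x * Γ.mu x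

/-- The resistance between `A` and `B`: the reciprocal of the infimum of the Dirichlet energy
`(-Δ f, f)` over the finitely supported `f` with `f = 1` on `A` and `f = 0` on `B`. -/
noncomputable def resistance (A B : Set V) : ℝ≥0∞ :=
  (⨅ (f : V →₀ ℝ) (_ : ∀ x ∈ A, f x = 1) (_ : ∀ x ∈ B, f x = 0),
    ENNReal.ofReal (Γ.innerMu (fun x => - Γ.laplace f x) f))⁻¹

/-- `ρ(x, r, R)`, the resistance between `B(x, r)` and the complement of `B(x, R)`. -/
noncomputable def annulusRes (x : V) (r R : ℝ) : ℝ≥0∞ :=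
  Γ.resistance (Γ.ball x r) (Γ.ball x R)ᶜ

/-- The condition `(p₀)`. -/
def CondP0 : Prop := ∃ p₀ : ℝ, 0 < p₀ ∧ ∀ x y, Γ.Edge x y → p₀ ≤ Γ.w x y / Γ.mu x

/-- Volume doubling `(VD)`. -/
def VolumeDoubling : Prop :=
  ∃ D : ℝ, 0 < D ∧ ∀ (x : V) (R : ℝ), 0 < R →
    Γ.ballVol x (2 * R) ≤ ENNReal.ofReal D * Γ.ballVol x R

/-- `u` is harmonic on `A`. -/
def HarmonicOn (u : V → ℝ) (A : Set V) : Prop := ∀ x ∈ A, Γ.markov u x = u x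

/-- The elliptic Harnack inequality `(H)`. Harmonicity on a ball only involves the values of `u` on
the ball and at the neighbours of its points, so that `u` may be taken to be zero elsewhere. -/
def EllipticHarnack : Prop :=
  ∃ H : ℝ, 1 < H ∧ ∀ (x : V) (R : ℝ), 0 < R → ∀ u : V → ℝ, (∀ y, 0 ≤ u y) →
    Γ.HarmonicOn u (Γ.ball x (2 * R)) →
    ∀ y ∈ Γ.ball x R, ∀ z ∈ Γ.ball x R, u y ≤ H * u z

/-- The anti-doubling property of `ρ v`. -/
def AntiDoublingResVol : Prop :=
  ∃ A : ℝ, 1 < A ∧ ∀ (x : V) (R : ℝ), 0 < R →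
    2 * (Γ.annulusRes x R (2 * R) * Γ.annulusVol x R (2 * R)) ≤
      Γ.annulusRes x (A * R) (2 * (A * R)) * Γ.annulusVol x (A * R) (2 * (A * R))

theorem mu_pos [Nontrivial V] (x : V) : 0 < Γ.mu x := by
  obtain ⟨y, hy⟩ := Γ.connected.preconnected.exists_adj_of_nontrivial x
  have hw : 0 < Γ.w x y := by
    rcases (SimpleGraph.fromRel_adj _ _ _).1 hy with ⟨-, h | h⟩
    · exact h
    · rw [Γ.symm]; exact h
  exact (Γ.summable x).tsum_pos (Γ.nonneg x) y hw

theorem hasSum_P [Nontrivial V] (x : V) : HasSum (fun y => ENNReal.ofReal (Γ.P x y)) 1 := by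
  have h : HasSum (Γ.P x) 1 := by
    have := (Γ.summable x).hasSum.div_const (Γ.mu x)
    rwa [show (∑' y, Γ.w x y) = Γ.mu x from rfl, div_self (Γ.mu_pos x).ne'] at this
  have h0 : ∀ y, 0 ≤ Γ.P x y := fun y => div_nonneg (Γ.nonneg x y) (Γ.mu_pos x).le
  rw [← ENNReal.ofReal_one, ← h.tsum_eq, ENNReal.ofReal_tsum_of_nonneg h0 h.summable]
  exact ENNReal.summable.hasSum

/-- The law `P(x, ·)` of one step of the random walk from `x`. -/
noncomputable def stepPMF [Nontrivial V] (x : V) : PMF V :=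
  ⟨fun y => ENNReal.ofReal (Γ.P x y), Γ.hasSum_P x⟩

variable [MeasurableSpace V] [DiscreteMeasurableSpace V]

/-- The transition from the history `(X_0, …, X_n)` to `X_{n+1}`: a step from `X_n`. -/
noncomputable def stepKernel [Nontrivial V] [Countable V] (n : ℕ) :
    Kernel (Finset.Iic n → V) V :=
  (Kernel.ofFunOfCountable fun x => (Γ.stepPMF x).toMeasure).comap
    (fun h => h ⟨n, Finset.mem_Iic.2 le_rfl⟩) (measurable_pi_apply _)

instance [Nontrivial V] [Countable V] (n : ℕ) : IsMarkovKernel (Γ.stepKernel n) :=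
  ⟨fun h => inferInstanceAs
    (IsProbabilityMeasure (Γ.stepPMF (h ⟨n, Finset.mem_Iic.2 le_rfl⟩)).toMeasure)⟩

/-- The law on path space `ℕ → V` of the random walk `(X_n)` started at `X_0 = x`. -/
noncomputable def walkLaw [Nontrivial V] [Countable V] (x : V) : Measure (ℕ → V) :=
  Kernel.trajMeasure (X := fun _ => V) (Measure.dirac x) Γ.stepKernel

/-- The exit time `T_A = min {k : X_k ∉ A}` of a path (`∞` if the path never leaves `A`). -/
noncomputable def exitTime {V : Type*} (A : Set V) (X : ℕ → V) : ℝ≥0∞ :=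
  ⨅ (k : ℕ) (_ : X k ∉ A), (k : ℝ≥0∞)

/-- The mean exit time `E_z(A) = 𝔼(T_A | X_0 = z)`. -/
noncomputable def meanExit [Nontrivial V] [Countable V] (z : V) (A : Set V) : ℝ≥0∞ :=
  ∫⁻ X, exitTime A X ∂(Γ.walkLaw z)

/-- `E(x, R) = E_x(B(x, R))`. -/
noncomputable def E [Nontrivial V] [Countable V] (x : V) (R : ℝ) : ℝ≥0∞ :=
  Γ.meanExit x (Γ.ball x R)

end WeightedGraph

/-! Everything is read off the Green function `g` of the walk killed outside `B(x, 2R)`, with pole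
`x`. Its integral against `μ` is the mean exit time (`LocallyFinite.meanExit_eq_sum`). Let `a` be
the minimum of `g` over `B(x, R)`.

Truncating `g` at level `a` gives a test function, so `a ≤ ρ(x, R, 2R)` (`le_resistance`).
Conversely, if `g ≤ C a` outside the interior of `B(x, R)`, the reproducing property of `g` and
Cauchy-Schwarz give `ρ ≤ C a` (`resistance_le`). That bound is a Harnack inequality for `g` away
from its pole (`green_harnack`). Annuli need not be connected, so a chain of balls between two
points may be forced close to the pole; `HarnackWith.green_le` gets around this by moving the pole
with the symmetry of the Green function.

With `a ≃ ρ`, the bound `ρ v ≤ C E` follows from `E ≥ a V(x, R)` and volume doubling. For the other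
bound, the maximum principle gives `g ≤ g' + C a`, where `g'` is the Green function of `B(x, 2R/A)`,
hence `E(x, 2R) ≤ E(x, 2R/A) + M ρ v`. Anti-doubling halves `ρ v` from scale `R` to `R/A`, so
iterating produces a geometric series (`E_le_resVol`). Doubling also provides `V(x, 2R) ≤ C v(x, R,
2R)` (`ballVol_le_annulusVol`). -/

namespace WeightedGraph

/-! ### Graph distance, geodesics and finiteness of balls. -/

section Distance

variable {V : Type*} (Γ : WeightedGraph V)

theorem adj_iff {x y : V} : (weightAdjacency Γ.w).Adj x y ↔ x ≠ y ∧ 0 < Γ.w x y := by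
  rw [weightAdjacency, SimpleGraph.fromRel_adj, Γ.symm y x, or_self]

theorem dist_self (x : V) : Γ.dist x x = 0 := SimpleGraph.dist_self

theorem dist_comm (x y : V) : Γ.dist x y = Γ.dist y x := SimpleGraph.dist_comm

theorem dist_triangle (x y z : V) : Γ.dist x z ≤ Γ.dist x y + Γ.dist y z :=
  Γ.connected.dist_triangle

theorem dist_eq_zero {x y : V} : Γ.dist x y = 0 ↔ x = y :=
  Γ.connected.dist_eq_zero_iff

theorem dist_le_one {x y : V} (h : 0 < Γ.w x y) : Γ.dist x y ≤ 1 := by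
  by_cases hxy : x = y
  · simp [hxy, dist_self]
  · exact (SimpleGraph.dist_eq_one_iff_adj.2 (Γ.adj_iff.2 ⟨hxy, h⟩)).le

theorem dist_le_succ {x y z : V} (h : 0 < Γ.w y z) : Γ.dist x z ≤ Γ.dist x y + 1 :=
  (Γ.dist_triangle x y z).trans (Nat.add_le_add_left (Γ.dist_le_one h) _)

/-- A geodesic from `x` to `y`: consecutive points are joined by an edge. -/
theorem exists_geodesic (x y : V) : ∃ γ : ℕ → V, γ 0 = x ∧ γ (Γ.dist x y) = y ∧
    (∀ t < Γ.dist x y, 0 < Γ.w (γ t) (γ (t + 1))) ∧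
    (∀ s t, s ≤ t → Γ.dist (γ s) (γ t) ≤ t - s) ∧
    ∀ t ≤ Γ.dist x y, Γ.dist x (γ t) = t := by
  obtain ⟨p, hp⟩ := Γ.connected.exists_walk_length_eq_dist x y
  have hp' : p.length = Γ.dist x y := hp
  have hadj : ∀ t < Γ.dist x y, 0 < Γ.w (p.getVert t) (p.getVert (t + 1)) := fun t ht =>
    (Γ.adj_iff.1 (p.adj_getVert_succ (by rw [hp']; exact ht))).2
  -- Past its end `getVert` is constant, so this holds for every `t`, and the Lipschitz bound below
  -- needs no restriction on the times.
  have hstep : ∀ t, Γ.dist (p.getVert t) (p.getVert (t + 1)) ≤ 1 := by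
    intro t
    by_cases ht : t < Γ.dist x y
    · exact Γ.dist_le_one (hadj t ht)
    · rw [p.getVert_of_length_le (by omega), p.getVert_of_length_le (by omega), dist_self]
      exact zero_le_one
  have hmono : ∀ s t, s ≤ t → Γ.dist (p.getVert s) (p.getVert t) ≤ t - s := by
    intro s t hst
    induction t, hst using Nat.le_induction with
    | base => simp [dist_self]
    | succ t hst ih =>
      have := Γ.dist_triangle (p.getVert s) (p.getVert t) (p.getVert (t + 1))
      have := hstep t
      omega
  refine ⟨p.getVert, p.getVert_zero, by rw [← hp', p.getVert_length], hadj, hmono, ?_⟩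
  intro t ht
  have h1 := hmono 0 t (Nat.zero_le _)
  have h2 := hmono t _ ht
  have h3 := Γ.dist_triangle x (p.getVert t) y
  rw [← hp', p.getVert_length, hp'] at h2
  rw [p.getVert_zero] at h1
  omega

theorem mem_ball {x y : V} {R : ℝ} : y ∈ Γ.ball x R ↔ (Γ.dist x y : ℝ) < R := Iff.rfl

theorem mem_ball_self {x : V} {R : ℝ} (hR : 0 < R) : x ∈ Γ.ball x R := by
  rw [mem_ball, dist_self]; exact_mod_cast hR

theorem ball_mono (x : V) {r R : ℝ} (h : r ≤ R) : Γ.ball x r ⊆ Γ.ball x R :=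
  fun _ hy => lt_of_lt_of_le hy h

/-- Every vertex has finitely many neighbours. -/
def LocallyFinite : Prop := ∀ x, (Function.support (Γ.w x)).Finite

theorem w_eq_zero_of_not_pos {x y : V} (h : ¬ 0 < Γ.w x y) : Γ.w x y = 0 :=
  le_antisymm (not_lt.1 h) (Γ.nonneg x y)

/-- Each edge at `x` weighs at least `p₀ μ(x)`, and a summable family has only finitely many such
terms. -/
theorem CondP0.locallyFinite [Nontrivial V] {Γ : WeightedGraph V} (h : Γ.CondP0) :
    Γ.LocallyFinite := by
  obtain ⟨p, hp, hP⟩ := h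
  intro x
  have hs := (Γ.summable x).tendsto_cofinite_zero
  have hlt : ∀ᶠ y in Filter.cofinite, Γ.w x y < p * Γ.mu x :=
    hs.eventually (gt_mem_nhds (mul_pos hp (Γ.mu_pos x)))
  refine (Filter.eventually_cofinite.1 hlt).subset fun y hy => ?_
  have hy' : 0 < Γ.w x y := lt_of_le_of_ne (Γ.nonneg x y) (Ne.symm hy)
  exact not_lt.2 ((le_div_iff₀ (Γ.mu_pos x)).1 (hP x y hy'))

variable {Γ}

theorem LocallyFinite.finite_closedBall (h : Γ.LocallyFinite) (x : V) (n : ℕ) :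
    {y | Γ.dist x y ≤ n}.Finite := by
  induction n with
  | zero =>
    refine (Set.finite_singleton x).subset fun y hy => ?_
    exact (Γ.dist_eq_zero.1 (Nat.le_zero.1 hy)).symm
  | succ n ih =>
    refine (ih.union (ih.biUnion fun z _ => h z)).subset fun y hy => ?_
    by_cases hn : Γ.dist x y ≤ n
    · exact Or.inl hn
    · right
      obtain ⟨γ, -, h1, hw, -, hd⟩ := Γ.exists_geodesic x y
      have hy' : Γ.dist x y ≤ n + 1 := hy
      have hxy : Γ.dist x y = n + 1 := by omega
      rw [hxy] at h1 hw hd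
      refine Set.mem_biUnion (x := γ n) (by simp [hd n (by omega)]) ?_
      have := hw n (by omega)
      rw [h1] at this
      exact this.ne'

theorem LocallyFinite.finite_ball (h : Γ.LocallyFinite) (x : V) (R : ℝ) :
    (Γ.ball x R).Finite := by
  refine (h.finite_closedBall x ⌈R⌉₊).subset fun y hy => ?_
  have : (Γ.dist x y : ℝ) ≤ ⌈R⌉₊ := (le_of_lt hy).trans (Nat.le_ceil R)
  exact_mod_cast this

/-- Balls are finite and `V` is not, so some vertex lies beyond distance `n`; a geodesic to it
crosses every sphere on the way. -/
theorem LocallyFinite.exists_dist_eq [Infinite V] (h : Γ.LocallyFinite) (x : V) (n : ℕ) :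
    ∃ y, Γ.dist x y = n := by
  obtain ⟨y, hy⟩ := (h.finite_closedBall x n).exists_notMem
  obtain ⟨γ, -, -, -, -, hd⟩ := Γ.exists_geodesic x y
  exact ⟨γ n, hd n (not_le.1 hy).le⟩

end Distance

/-! ### The Markov operator and the maximum principle. -/

section Markov

variable {V : Type*} {Γ : WeightedGraph V}

theorem P_nonneg [Nontrivial V] (x y : V) : 0 ≤ Γ.P x y :=
  div_nonneg (Γ.nonneg x y) (Γ.mu_pos x).le

theorem P_pos [Nontrivial V] {x y : V} (h : 0 < Γ.w x y) : 0 < Γ.P x y :=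
  div_pos h (Γ.mu_pos x)

theorem P_eq_zero {x y : V} (h : ¬ 0 < Γ.w x y) : Γ.P x y = 0 := by
  rw [P, Γ.w_eq_zero_of_not_pos h, zero_div]

theorem tsum_P [Nontrivial V] (x : V) : ∑' y, Γ.P x y = 1 := by
  simp only [P]
  rw [tsum_div_const]
  exact div_self (Γ.mu_pos x).ne'

theorem LocallyFinite.summable_P (h : Γ.LocallyFinite) (f : V → ℝ) (x : V) :
    Summable fun y => Γ.P x y * f y := by
  refine summable_of_hasFiniteSupport ((h x).subset fun y hy => ?_)
  simp only [Function.mem_support, P] at hy ⊢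
  intro h0
  exact hy (by rw [h0, zero_div, zero_mul])

theorem LocallyFinite.markov_add (h : Γ.LocallyFinite) (f g : V → ℝ) (x : V) :
    Γ.markov (f + g) x = Γ.markov f x + Γ.markov g x := by
  rw [markov, markov, markov, ← (h.summable_P f x).tsum_add (h.summable_P g x)]
  exact tsum_congr fun y => by rw [Pi.add_apply, mul_add]

theorem markov_smul (c : ℝ) (f : V → ℝ) (x : V) : Γ.markov (c • f) x = c * Γ.markov f x := by
  rw [markov, markov, ← tsum_mul_left]
  exact tsum_congr fun y => by rw [Pi.smul_apply, smul_eq_mul]; ring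

theorem markov_neg (f : V → ℝ) (x : V) : Γ.markov (-f) x = - Γ.markov f x := by
  rw [markov, markov, ← tsum_neg]
  exact tsum_congr fun y => by rw [Pi.neg_apply]; ring

theorem LocallyFinite.markov_sub (h : Γ.LocallyFinite) (f g : V → ℝ) (x : V) :
    Γ.markov (f - g) x = Γ.markov f x - Γ.markov g x := by
  rw [sub_eq_add_neg, h.markov_add, markov_neg, sub_eq_add_neg]

theorem markov_sum (h : Γ.LocallyFinite) {ι : Type*} (s : Finset ι) (F : ι → V → ℝ) (x : V) :
    Γ.markov (fun y => ∑ i ∈ s, F i y) x = ∑ i ∈ s, Γ.markov (F i) x := by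
  simp only [markov, Finset.mul_sum]
  exact Summable.tsum_finsetSum fun i _ => h.summable_P (F i) x

theorem markov_nonneg [Nontrivial V] {f : V → ℝ} (hf : ∀ y, 0 ≤ f y) (x : V) :
    0 ≤ Γ.markov f x := tsum_nonneg fun y => mul_nonneg (P_nonneg x y) (hf y)

theorem markov_congr {f g : V → ℝ} {x : V} (hfg : ∀ y, 0 < Γ.w x y → f y = g y) :
    Γ.markov f x = Γ.markov g x := by
  refine tsum_congr fun y => ?_
  by_cases hy : 0 < Γ.w x y
  · rw [hfg y hy]
  · rw [P_eq_zero hy, zero_mul, zero_mul]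

/-- A subharmonic function that attains a local maximum is constant on the neighbours. -/
theorem LocallyFinite.eq_of_max [Nontrivial V] (h : Γ.LocallyFinite) {u : V → ℝ} {a : V}
    (hsub : u a ≤ Γ.markov u a) (hmax : ∀ y, 0 < Γ.w a y → u y ≤ u a) :
    ∀ y, 0 < Γ.w a y → u y = u a := by
  intro y hy
  have hnn : ∀ z, 0 ≤ Γ.P a z * ((fun _ : V => u a) - u) z := by
    intro z
    by_cases hz : 0 < Γ.w a z
    · exact mul_nonneg (P_nonneg a z) (sub_nonneg.2 (hmax z hz))
    · rw [P_eq_zero hz, zero_mul]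
  have hle := (h.summable_P ((fun _ : V => u a) - u) a).le_tsum y fun z _ => hnn z
  have hm : Γ.markov ((fun _ : V => u a) - u) a = u a - Γ.markov u a := by
    rw [h.markov_sub]
    congr 1
    rw [markov, tsum_mul_right, tsum_P, one_mul]
  rw [show (∑' z, Γ.P a z * ((fun _ : V => u a) - u) z) = Γ.markov ((fun _ : V => u a) - u) a from rfl,
    hm] at hle
  have h1 : Γ.P a y * (u a - u y) ≤ 0 := by
    refine hle.trans ?_
    linarith
  have h2 : u a - u y ≤ 0 := by
    by_contra hc
    exact absurd h1 (not_le.2 (mul_pos (P_pos hy) (not_le.1 hc)))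
  exact le_antisymm (hmax y hy) (by linarith)

/-- A set closed under the edges is everything, by connectedness. -/
theorem mem_of_edge_closed {Γ : WeightedGraph V} {S : Set V} {a : V} (ha : a ∈ S)
    (hS : ∀ y ∈ S, ∀ z, 0 < Γ.w y z → z ∈ S) (z : V) : z ∈ S := by
  obtain ⟨γ, h0, h1, hw, -, -⟩ := Γ.exists_geodesic a z
  have : ∀ t ≤ Γ.dist a z, γ t ∈ S := by
    intro t
    induction t with
    | zero => intro _; rwa [h0]
    | succ t ih => intro ht; exact hS _ (ih (by omega)) _ (hw t (by omega))
  have := this _ le_rfl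
  rwa [h1] at this

/-- The maximum principle on a finite set, with the bound on the outer boundary. -/
theorem LocallyFinite.max_principle [Infinite V] (h : Γ.LocallyFinite) {D : Set V}
    (hD : D.Finite) {u : V → ℝ} {c : ℝ} (hsub : ∀ y ∈ D, u y ≤ Γ.markov u y)
    (hbd : ∀ y ∈ D, ∀ z ∉ D, 0 < Γ.w y z → u z ≤ c) : ∀ y ∈ D, u y ≤ c := by
  intro y hy
  by_contra hc
  obtain ⟨a, haD, ha⟩ := hD.exists_maximalFor u D ⟨y, hy⟩
  have hmax : ∀ z ∈ D, u z ≤ u a := fun z hz => by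
    rcases le_total (u z) (u a) with hza | hza
    · exact hza
    · exact ha hz hza
  have hca : c < u a := (not_le.1 hc).trans_le (hmax y hy)
  -- A maximum above `c` spreads to all neighbours and cannot reach the outer boundary. By
  -- connectedness it then fills `V`, which is impossible because `D` is finite and `V` is infinite.
  have hclosed : ∀ z ∈ {z | z ∈ D ∧ u z = u a}, ∀ z', 0 < Γ.w z z' →
      z' ∈ {z | z ∈ D ∧ u z = u a} := by
    rintro z ⟨hz, hza⟩ z' hzz'
    have hloc : ∀ b, 0 < Γ.w z b → u b ≤ u z := by
      intro b hb
      by_cases hbD : b ∈ D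
      · rw [hza]; exact hmax b hbD
      · rw [hza]; exact (hbd z hz b hbD hb).trans hca.le
    have heq := h.eq_of_max (hsub z hz) hloc z' hzz'
    refine ⟨?_, heq.trans hza⟩
    by_contra hz'
    have := hbd z hz z' hz' hzz'
    rw [heq, hza] at this
    exact absurd this (not_le.2 hca)
  obtain ⟨z, hz⟩ := hD.exists_notMem
  exact hz (mem_of_edge_closed (S := {z | z ∈ D ∧ u z = u a}) ⟨haD, rfl⟩ hclosed z).1

theorem LocallyFinite.min_principle [Infinite V] (h : Γ.LocallyFinite) {D : Set V}
    (hD : D.Finite) {u : V → ℝ} {c : ℝ} (hsup : ∀ y ∈ D, Γ.markov u y ≤ u y)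
    (hbd : ∀ y ∈ D, ∀ z ∉ D, 0 < Γ.w y z → c ≤ u z) : ∀ y ∈ D, c ≤ u y := by
  intro y hy
  have := h.max_principle hD (u := -u) (c := -c)
    (fun z hz => by rw [markov_neg]; exact neg_le_neg (hsup z hz))
    (fun z hz z' hz' hw => neg_le_neg (hbd z hz z' hz' hw)) y hy
  exact neg_le_neg_iff.1 this

end Markov

/-! ### The Poisson equation and the Green function of a finite set. -/

section Green

variable {V : Type*} {Γ : WeightedGraph V}

open Classical in
/-- The Dirichlet problem for the Poisson equation on a finite set. -/
theorem LocallyFinite.exists_poisson [Infinite V] (h : Γ.LocallyFinite) {D : Set V}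
    (hD : D.Finite) (φ : V → ℝ) :
    ∃ f : V → ℝ, (∀ y ∉ D, f y = 0) ∧ ∀ y ∈ D, f y - Γ.markov f y = φ y := by
  have := hD.to_subtype
  let ext : (D → ℝ) →ₗ[ℝ] (V → ℝ) :=
    { toFun := fun f y => if hy : y ∈ D then f ⟨y, hy⟩ else 0
      map_add' := fun f g => by
        funext y; by_cases hy : y ∈ D <;> simp [hy]
      map_smul' := fun c f => by
        funext y; by_cases hy : y ∈ D <;> simp [hy] }
  have hout : ∀ f, ∀ y ∉ D, ext f y = 0 := fun f y hy => dif_neg hy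
  have hin : ∀ f (y : D), ext f y = f y := fun f y => dif_pos y.2
  let T : (D → ℝ) →ₗ[ℝ] (D → ℝ) :=
    { toFun := fun f y => ext f y - Γ.markov (ext f) y
      map_add' := fun f g => by
        funext y; simp only [map_add, h.markov_add, Pi.add_apply]; ring
      map_smul' := fun c f => by
        funext y
        simp only [map_smul, markov_smul, Pi.smul_apply, smul_eq_mul, RingHom.id_apply]; ring }
  -- In finite dimension uniqueness gives existence, and uniqueness is the maximum principle.
  have hinj : Function.Injective T := by
    rw [← LinearMap.ker_eq_bot, LinearMap.ker_eq_bot']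
    intro f hf
    have hharm : ∀ y ∈ D, ext f y = Γ.markov (ext f) y := fun y hy =>
      sub_eq_zero.1 (congrFun hf ⟨y, hy⟩)
    funext y
    rw [← hin f y]
    refine le_antisymm ?_ ?_
    · exact h.max_principle hD (fun y hy => (hharm y hy).le)
        (fun y _ z hz _ => (hout f z hz).le) y y.2
    · exact h.min_principle hD (fun y hy => (hharm y hy).ge)
        (fun y _ z hz _ => (hout f z hz).ge) y y.2
  obtain ⟨f, hf⟩ := (LinearMap.injective_iff_surjective.1 hinj) fun y => φ y
  exact ⟨ext f, hout f, fun y hy => congrFun hf ⟨y, hy⟩⟩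

open Classical in
/-- The Green function `g^D(y, ·)` of the walk killed on leaving `D`, normalized by `μ`. -/
noncomputable def green (Γ : WeightedGraph V) (D : Set V) (y : V) : V → ℝ :=
  if h : ∃ f : V → ℝ, (∀ z ∉ D, f z = 0) ∧
    ∀ z ∈ D, f z - Γ.markov f z = if z = y then (Γ.mu y)⁻¹ else 0 then h.choose else 0

variable {D : Set V}

open Classical in
theorem LocallyFinite.green_spec [Infinite V] (h : Γ.LocallyFinite) (hD : D.Finite) (y : V) :
    (∀ z ∉ D, Γ.green D y z = 0) ∧
      ∀ z ∈ D, Γ.green D y z - Γ.markov (Γ.green D y) z = if z = y then (Γ.mu y)⁻¹ else 0 := by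
  have hex := h.exists_poisson hD fun z => if z = y then (Γ.mu y)⁻¹ else 0
  rw [green, dif_pos hex]
  exact hex.choose_spec

theorem LocallyFinite.green_eq_zero [Infinite V] (h : Γ.LocallyFinite) (hD : D.Finite) (y : V)
    {z : V} (hz : z ∉ D) : Γ.green D y z = 0 := (h.green_spec hD y).1 z hz

theorem LocallyFinite.green_self [Infinite V] (h : Γ.LocallyFinite) (hD : D.Finite) {y : V}
    (hy : y ∈ D) : Γ.green D y y - Γ.markov (Γ.green D y) y = (Γ.mu y)⁻¹ := by
  rw [(h.green_spec hD y).2 y hy, if_pos rfl]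

theorem LocallyFinite.markov_green [Infinite V] (h : Γ.LocallyFinite) (hD : D.Finite) {y z : V}
    (hz : z ∈ D) (hzy : z ≠ y) : Γ.markov (Γ.green D y) z = Γ.green D y z := by
  have := (h.green_spec hD y).2 z hz
  rw [if_neg hzy] at this
  linarith

theorem LocallyFinite.markov_green_le [Infinite V] (h : Γ.LocallyFinite) (hD : D.Finite)
    (y : V) {z : V} (hz : z ∈ D) : Γ.markov (Γ.green D y) z ≤ Γ.green D y z := by
  by_cases hzy : z = y
  · subst hzy
    have := h.green_self hD hz
    have := inv_pos.2 (Γ.mu_pos z)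
    linarith
  · exact (h.markov_green hD hz hzy).le

theorem LocallyFinite.green_nonneg [Infinite V] (h : Γ.LocallyFinite) (hD : D.Finite)
    (y z : V) : 0 ≤ Γ.green D y z := by
  by_cases hz : z ∈ D
  · exact h.min_principle hD (fun a ha => h.markov_green_le hD y ha)
      (fun _ _ b hb _ => (h.green_eq_zero hD y hb).ge) z hz
  · exact (h.green_eq_zero hD y hz).ge

theorem LocallyFinite.green_self_pos [Infinite V] (h : Γ.LocallyFinite) (hD : D.Finite) {y : V}
    (hy : y ∈ D) : 0 < Γ.green D y y := by
  have h1 := h.green_self hD hy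
  have h2 := inv_pos.2 (Γ.mu_pos y)
  have h3 := markov_nonneg (Γ := Γ) (fun z => h.green_nonneg hD y z) y
  linarith

/-- The two Green functions have the same source at `x`, so their difference is harmonic in `D'`,
and outside `D'` it is at most `b`. -/
theorem LocallyFinite.green_le_green_add [Infinite V] (h : Γ.LocallyFinite) (hD : D.Finite)
    {D' : Set V} (hD' : D' ⊆ D) {x : V} {b : ℝ} (hb : ∀ z ∉ D', Γ.green D x z ≤ b) (z : V) :
    Γ.green D x z ≤ Γ.green D' x z + b := by
  classical
  have hD'f := hD.subset hD'
  by_cases hz : z ∈ D'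
  · have hmax := h.max_principle hD'f (u := Γ.green D x - Γ.green D' x) (c := b) ?_ ?_ z hz
    · have : Γ.green D x z - Γ.green D' x z ≤ b := hmax
      linarith
    · intro y hy
      rw [h.markov_sub, Pi.sub_apply]
      have h1 := (h.green_spec hD x).2 y (hD' hy)
      have h2 := (h.green_spec hD'f x).2 y hy
      linarith
    · intro y _ c hc _
      rw [Pi.sub_apply, h.green_eq_zero hD'f x hc, sub_zero]
      exact hb c hc
  · rw [h.green_eq_zero hD'f x hz, zero_add]
    exact hb z hz

end Green

/-! ### The Dirichlet form, summation by parts and symmetry of the Green function. -/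

section Energy

variable {V : Type*} {Γ : WeightedGraph V} {D : Set V}

/-- The Dirichlet form `(-Δ f, g)_μ`. -/
noncomputable def energy (Γ : WeightedGraph V) (f g : V → ℝ) : ℝ :=
  Γ.innerMu (fun x => - Γ.laplace f x) g

open Classical in
theorem LocallyFinite.exists_nhd (h : Γ.LocallyFinite) (hD : D.Finite) :
    ∃ S : Finset V, D ⊆ S ∧ ∀ x ∈ D, ∀ y ∉ S, Γ.w x y = 0 := by
  refine ⟨hD.toFinset ∪ hD.toFinset.biUnion fun x => (h x).toFinset, ?_, ?_⟩
  · intro x hx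
    simp [hx]
  · intro x hx y hy
    by_contra hw
    refine hy (Finset.mem_union_right _ (Finset.mem_biUnion.2 ⟨x, by simpa using hx, ?_⟩))
    simpa using hw

/-- Summation by parts. `S` contains `D` and all its neighbours, which makes the sums finite; only
`g` has to vanish off `D`. Symmetrising in `x` and `y` uses the symmetry of the weights. -/
theorem energy_eq_sum [Nontrivial V] {S : Finset V}
    (hDS : D ⊆ S) (hS : ∀ x ∈ D, ∀ y ∉ S, Γ.w x y = 0) {f g : V → ℝ}
    (hg : ∀ x ∉ D, g x = 0) :
    Γ.energy f g = (∑ x ∈ S, ∑ y ∈ S, Γ.w x y * ((f x - f y) * (g x - g y))) / 2 := by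
  have hmu : ∀ x ∈ D, Γ.mu x = ∑ y ∈ S, Γ.w x y := fun x hx =>
    tsum_eq_sum fun y hy => hS x hx y hy
  have hterm : ∀ x ∈ S, - Γ.laplace f x * g x * Γ.mu x =
      ∑ y ∈ S, Γ.w x y * ((f x - f y) * g x) := by
    intro x _
    by_cases hx : x ∈ D
    · have hm : Γ.markov f x = ∑ y ∈ S, Γ.P x y * f y := tsum_eq_sum fun y hy => by
        rw [P, hS x hx y hy, zero_div, zero_mul]
      have hne := (Γ.mu_pos x).ne'
      have hmm : Γ.markov f x * Γ.mu x = ∑ y ∈ S, Γ.w x y * f y := by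
        rw [hm, Finset.sum_mul]
        refine Finset.sum_congr rfl fun y _ => ?_
        rw [P]
        field_simp
      have hs : ∑ y ∈ S, Γ.w x y * ((f x - f y) * g x) =
          (Γ.mu x * f x - Γ.markov f x * Γ.mu x) * g x := by
        rw [hmm, hmu x hx, Finset.sum_mul, ← Finset.sum_sub_distrib, Finset.sum_mul]
        exact Finset.sum_congr rfl fun y _ => by ring
      rw [hs, laplace]
      ring
    · rw [hg x hx]
      simp
  have h1 : Γ.energy f g = ∑ x ∈ S, ∑ y ∈ S, Γ.w x y * ((f x - f y) * g x) := by
    rw [energy, innerMu, tsum_eq_sum (s := S), Finset.sum_congr rfl hterm]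
    intro x hx
    rw [hg x fun hxD => hx (hDS hxD)]
    ring
  have h2 : Γ.energy f g = ∑ x ∈ S, ∑ y ∈ S, Γ.w x y * ((f y - f x) * g y) := by
    rw [h1, Finset.sum_comm]
    exact Finset.sum_congr rfl fun x _ => Finset.sum_congr rfl fun y _ => by rw [Γ.symm y x]
  have h3 : ∑ x ∈ S, ∑ y ∈ S, Γ.w x y * ((f x - f y) * (g x - g y)) =
      Γ.energy f g + Γ.energy f g := by
    nth_rw 1 [h1]
    rw [h2, ← Finset.sum_add_distrib]
    refine Finset.sum_congr rfl fun x _ => ?_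
    rw [← Finset.sum_add_distrib]
    exact Finset.sum_congr rfl fun y _ => by ring
  rw [h3]; ring

/-- The reproducing property of the Green function. -/
theorem LocallyFinite.energy_green [Infinite V] (h : Γ.LocallyFinite) (hD : D.Finite) {y : V}
    (hy : y ∈ D) {f : V → ℝ} (hf : ∀ x ∉ D, f x = 0) : Γ.energy (Γ.green D y) f = f y := by
  rw [energy, innerMu, tsum_eq_single y]
  · have := h.green_self hD hy
    rw [laplace, neg_sub, this]
    have := (Γ.mu_pos y).ne'
    field_simp
  · intro z hz
    by_cases hzD : z ∈ D
    · rw [laplace, h.markov_green hD hzD hz]; ring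
    · rw [hf z hzD]; ring

theorem LocallyFinite.energy_comm [Nontrivial V] (h : Γ.LocallyFinite) (hD : D.Finite)
    {f g : V → ℝ} (hf : ∀ x ∉ D, f x = 0) (hg : ∀ x ∉ D, g x = 0) :
    Γ.energy f g = Γ.energy g f := by
  obtain ⟨S, hDS, hS⟩ := h.exists_nhd hD
  rw [energy_eq_sum hDS hS hg, energy_eq_sum hDS hS hf]
  congr 1
  exact Finset.sum_congr rfl fun x _ => Finset.sum_congr rfl fun y _ => by ring

/-- By the reproducing property both sides equal the energy pairing of the two Green functions. -/
theorem LocallyFinite.green_comm [Infinite V] (h : Γ.LocallyFinite) (hD : D.Finite) {y z : V}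
    (hy : y ∈ D) (hz : z ∈ D) : Γ.green D y z = Γ.green D z y := by
  rw [← h.energy_green hD hz fun x hx => h.green_eq_zero hD y hx,
    h.energy_comm hD (fun x hx => h.green_eq_zero hD z hx) fun x hx => h.green_eq_zero hD y hx,
    h.energy_green hD hy fun x hx => h.green_eq_zero hD z hx]

end Energy

/-! ### Two-sided bounds of the resistance by level sets of the Green function. -/

section Resistance

variable {V : Type*} {Γ : WeightedGraph V} {D : Set V}

/-- Truncation is monotone and 1-Lipschitz, so truncated increments have the sign of the original
ones and are no larger. -/
theorem sq_min_sub_min_le (s t a : ℝ) :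
    (min s a - min t a) * (min s a - min t a) ≤ (s - t) * (min s a - min t a) := by
  rcases le_total s a with hs | hs <;> rcases le_total t a with ht | ht <;>
    simp only [min_eq_left, min_eq_right, hs, ht] <;> nlinarith

theorem energy_truncation_le [Nontrivial V] (h : Γ.LocallyFinite) (hD : D.Finite) {g : V → ℝ}
    (hg : ∀ x ∉ D, g x = 0) {a : ℝ} (ha : 0 ≤ a) :
    Γ.energy (fun z => min (g z) a) (fun z => min (g z) a) ≤
      Γ.energy g (fun z => min (g z) a) := by
  obtain ⟨S, hDS, hS⟩ := h.exists_nhd hD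
  have hm : ∀ x ∉ D, min (g x) a = 0 := fun x hx => by rw [hg x hx, min_eq_left ha]
  rw [energy_eq_sum hDS hS hm, energy_eq_sum hDS hS hm]
  refine div_le_div_of_nonneg_right ?_ zero_le_two
  exact Finset.sum_le_sum fun x _ => Finset.sum_le_sum fun y _ =>
    mul_le_mul_of_nonneg_left (sq_min_sub_min_le _ _ _) (Γ.nonneg x y)

theorem energy_smul_smul (c : ℝ) (f : V → ℝ) :
    Γ.energy (fun z => c * f z) (fun z => c * f z) = c ^ 2 * Γ.energy f f := by
  rw [energy, energy, innerMu, innerMu, ← tsum_mul_left]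
  refine tsum_congr fun x => ?_
  have : Γ.markov (fun z => c * f z) x = c * Γ.markov f x := markov_smul c f x
  rw [laplace, laplace, this]
  ring

/-- A lower bound of the Green function on `A` bounds the resistance from below. -/
theorem LocallyFinite.le_resistance [Infinite V] (h : Γ.LocallyFinite) (hD : D.Finite)
    {x : V} (hx : x ∈ D) {A : Set V} {a : ℝ} (ha : ∀ z ∈ A, a ≤ Γ.green D x z) :
    ENNReal.ofReal a ≤ Γ.resistance A Dᶜ := by
  rcases le_or_gt a 0 with h0 | h0
  · rw [ENNReal.ofReal_of_nonpos h0]; exact zero_le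
  set m : V → ℝ := fun z => min (Γ.green D x z) a with hmdef
  have hm : ∀ z ∉ D, m z = 0 := fun z hz => by
    rw [hmdef]; simp only [h.green_eq_zero hD x hz, min_eq_left h0.le]
  have hfin : ∀ z, a⁻¹ * m z ≠ 0 → z ∈ hD.toFinset := by
    intro z hz
    by_contra hzD
    exact hz (by rw [hm z (by simpa using hzD), mul_zero])
  set F : V →₀ ℝ := Finsupp.onFinset hD.toFinset (fun z => a⁻¹ * m z) hfin with hF
  have hFcoe : (F : V → ℝ) = fun z => a⁻¹ * m z := rfl
  rw [resistance, ENNReal.le_inv_iff_le_inv, ← ENNReal.ofReal_inv_of_pos h0]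
  refine iInf_le_of_le F (iInf_le_of_le ?_ (iInf_le_of_le ?_ ?_))
  · intro z hz
    rw [hFcoe]
    simp only [hmdef]
    rw [min_eq_right (ha z hz), inv_mul_cancel₀ h0.ne']
  · intro z hz
    rw [hFcoe]
    simp only [hm z hz, mul_zero]
  · refine ENNReal.ofReal_le_ofReal ?_
    change Γ.energy F F ≤ a⁻¹
    rw [hFcoe, energy_smul_smul]
    -- `E(m, m) ≤ E(g, m) = m(x) ≤ a`, so `m / a` has energy at most `1 / a`.
    have h1 := energy_truncation_le h hD (fun z hz => h.green_eq_zero hD x hz) h0.le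
    rw [h.energy_green hD hx hm] at h1
    have h2 : Γ.energy m m ≤ a := h1.trans (min_le_right _ _)
    calc a⁻¹ ^ 2 * Γ.energy m m ≤ a⁻¹ ^ 2 * a := by gcongr
      _ = a⁻¹ := by field_simp

/-- An upper bound of the Green function outside the interior of `A` bounds the resistance from
above. -/
theorem LocallyFinite.resistance_le [Infinite V] (h : Γ.LocallyFinite) (hD : D.Finite)
    {x : V} (hx : x ∈ D) {A : Set V} (hxA : x ∈ A) {b : ℝ} (hb : 0 < b)
    (hgb : ∀ y, (y ∉ A ∨ ∃ z ∉ A, 0 < Γ.w y z) → Γ.green D x y ≤ b) :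
    Γ.resistance A Dᶜ ≤ ENNReal.ofReal b := by
  rw [resistance, ENNReal.inv_le_iff_inv_le, ← ENNReal.ofReal_inv_of_pos hb]
  refine le_iInf fun f => le_iInf fun hfA => le_iInf fun hfD => ENNReal.ofReal_le_ofReal ?_
  change b⁻¹ ≤ Γ.energy f f
  have hf0 : ∀ z ∉ D, f z = 0 := hfD
  set g := Γ.green D x with hg
  have hg0 : ∀ z ∉ D, g z = 0 := fun z hz => h.green_eq_zero hD x hz
  set m : V → ℝ := fun z => min (g z) b with hmdef
  have hm : ∀ z ∉ D, m z = 0 := fun z hz => by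
    rw [hmdef]; simp only [hg0 z hz, min_eq_left hb.le]
  obtain ⟨S, hDS, hS⟩ := h.exists_nhd hD
  have hgf : Γ.energy g f = 1 := by rw [h.energy_green hD hx hf0, hfA x hxA]
  have hmm : Γ.energy m m ≤ b := by
    have h1 := energy_truncation_le h hD hg0 hb.le
    rw [h.energy_green hD hx hm] at h1
    exact h1.trans (min_le_right _ _)
  -- Young's inequality with weight `b`, after replacing `g` by its truncation `m` in the pairing
  -- with `f`. Together with `E(g, f) = f(x) = 1` and `E(m, m) ≤ b` it gives `b E(f, f) ≥ 1`.
  have hle : Γ.energy g f ≤ (b⁻¹ * Γ.energy m m + b * Γ.energy f f) / 2 := by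
    rw [energy_eq_sum hDS hS hf0, energy_eq_sum hDS hS hm, energy_eq_sum hDS hS hf0]
    rw [← mul_div_assoc, ← mul_div_assoc, ← add_div, div_div, ← div_div]
    refine div_le_div_of_nonneg_right ?_ zero_le_two
    rw [le_div_iff₀ two_pos, Finset.mul_sum, Finset.mul_sum, ← Finset.sum_add_distrib,
      Finset.sum_mul]
    refine Finset.sum_le_sum fun y _ => ?_
    rw [Finset.mul_sum, Finset.mul_sum, ← Finset.sum_add_distrib, Finset.sum_mul]
    refine Finset.sum_le_sum fun z _ => ?_
    -- Edges inside `A` do not contribute since `f` is constant there; at both ends of any other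
    -- edge `g ≤ b`, so truncation changes nothing.
    have hkey : Γ.w y z * ((g y - g z) * (f y - f z)) =
        Γ.w y z * ((m y - m z) * (f y - f z)) := by
      by_cases hw : 0 < Γ.w y z
      · by_cases hyz : y ∈ A ∧ z ∈ A
        · rw [hfA y hyz.1, hfA z hyz.2]; ring
        · have hy : g y ≤ b := by
            by_cases hyA : y ∈ A
            · exact hgb y (Or.inr ⟨z, fun hz => hyz ⟨hyA, hz⟩, hw⟩)
            · exact hgb y (Or.inl hyA)
          have hz : g z ≤ b := by
            by_cases hzA : z ∈ A
            · exact hgb z (Or.inr ⟨y, fun hy => hyz ⟨hy, hzA⟩, by rwa [Γ.symm]⟩)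
            · exact hgb z (Or.inl hzA)
          simp only [hmdef, min_eq_left hy, min_eq_left hz]
      · rw [Γ.w_eq_zero_of_not_pos hw]; ring
    rw [hkey]
    have hsq : (m y - m z) * (f y - f z) * 2 ≤
        b⁻¹ * ((m y - m z) * (m y - m z)) + b * ((f y - f z) * (f y - f z)) := by
      have h1 : 0 ≤ b⁻¹ * ((m y - m z) - b * (f y - f z)) ^ 2 := by positivity
      have h2 : b⁻¹ * ((m y - m z) - b * (f y - f z)) ^ 2 =
          b⁻¹ * ((m y - m z) * (m y - m z)) + b * ((f y - f z) * (f y - f z)) -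
            (m y - m z) * (f y - f z) * 2 := by
        field_simp; ring
      linarith
    have := mul_le_mul_of_nonneg_left hsq (Γ.nonneg y z)
    linarith
  have h1 : b⁻¹ * Γ.energy m m ≤ 1 := by
    rw [inv_mul_le_iff₀ hb, mul_one]; exact hmm
  rw [inv_le_iff_one_le_mul₀ hb]
  linarith

end Resistance

/-! ### Harnack inequality for the Green function away from its pole. -/

section Harnack

variable {V : Type*} {Γ : WeightedGraph V} {D : Set V}

/-- The elliptic Harnack inequality with constant `H`. -/
def HarnackWith (Γ : WeightedGraph V) (H : ℝ) : Prop :=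
  ∀ (x : V) (R : ℝ), 0 < R → ∀ u : V → ℝ, (∀ y, 0 ≤ u y) →
    Γ.HarmonicOn u (Γ.ball x (2 * R)) →
    ∀ y ∈ Γ.ball x R, ∀ z ∈ Γ.ball x R, u y ≤ H * u z

/-- Harnack's inequality along a chain of balls centred on a geodesic. -/
theorem HarnackWith.chain {H : ℝ} (hH : Γ.HarnackWith H) (hH1 : 1 ≤ H) {u : V → ℝ}
    (hu : ∀ y, 0 ≤ u y) {γ : ℕ → V} (hγ : ∀ s t, s ≤ t → Γ.dist (γ s) (γ t) ≤ t - s)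
    {j : ℕ} (hj : 0 < j) {s e : ℕ}
    (hharm : ∀ t, s ≤ t → t ≤ e → Γ.HarmonicOn u (Γ.ball (γ t) (4 * j))) (N : ℕ) :
    ∀ a b, s ≤ a → a ≤ b → b ≤ e → b - a ≤ N * j →
      u (γ a) ≤ H ^ N * u (γ b) ∧ u (γ b) ≤ H ^ N * u (γ a) := by
  have hj' : (0 : ℝ) < j := by exact_mod_cast hj
  induction N with
  | zero =>
    intro a b _ hab _ hN
    have : a = b := by omega
    subst this
    simp
  | succ N ih =>
    intro a b hsa hab hbe hN
    -- One link has length at most `j`; it fits in the open ball of radius `2j`, which is why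
    -- harmonicity is asked on radius `4j`.
    obtain ⟨c, hac, hcb, hcj, hbc⟩ : ∃ c, a ≤ c ∧ c ≤ b ∧ c - a ≤ j ∧ b - c ≤ N * j := by
      rw [add_mul, one_mul] at hN
      rcases le_total (a + j) b with h | h
      · exact ⟨a + j, by omega, h, by omega, by omega⟩
      · exact ⟨b, hab, le_rfl, by omega, by omega⟩
    obtain ⟨h1, h2⟩ := ih c b (hsa.trans hac) hcb hbe hbc
    have hball : ∀ t, a ≤ t → t ≤ c → γ t ∈ Γ.ball (γ a) (2 * j) := by
      intro t hat htc
      have h3 : Γ.dist (γ a) (γ t) ≤ j := (hγ a t hat).trans (by omega)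
      have h4 : (Γ.dist (γ a) (γ t) : ℝ) ≤ j := by exact_mod_cast h3
      rw [mem_ball]
      linarith
    have hstep := hH (γ a) (2 * j) (by linarith) u hu
      (by rw [show (2 : ℝ) * (2 * j) = 4 * j by ring]; exact hharm a hsa (hab.trans hbe))
    have hac1 := hstep _ (hball a le_rfl hac) _ (hball c hac le_rfl)
    have hac2 := hstep _ (hball c hac le_rfl) _ (hball a le_rfl hac)
    have hH0 : 0 ≤ H := zero_le_one.trans hH1
    constructor
    · calc u (γ a) ≤ H * u (γ c) := hac1
        _ ≤ H * (H ^ N * u (γ b)) := by gcongr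
        _ = H ^ (N + 1) * u (γ b) := by ring
    · calc u (γ b) ≤ H ^ N * u (γ c) := h2
        _ ≤ H ^ N * (H * u (γ a)) := by gcongr
        _ = H ^ (N + 1) * u (γ a) := by ring

theorem LocallyFinite.harmonicOn_green [Infinite V] (h : Γ.LocallyFinite) (hD : D.Finite) {y : V}
    {A : Set V} (hA : A ⊆ D) (hy : y ∉ A) : Γ.HarmonicOn (Γ.green D y) A :=
  fun _ hz => h.markov_green hD (hA hz) fun hzy => hy (hzy ▸ hz)

/-- Comparison of the Green function with pole `x` on two spheres around `x`. -/
theorem HarnackWith.green_le [Infinite V] {H : ℝ} (hH : Γ.HarnackWith H) (hH1 : 1 ≤ H)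
    (h : Γ.LocallyFinite) {x y z : V} {R : ℝ} {j N : ℕ} (hj : 0 < j)
    (hy : Γ.dist x y = 64 * j) (hz1 : 16 * j ≤ Γ.dist x z) (hz2 : Γ.dist x z ≤ N * j)
    (hR : 68 * (j : ℝ) ≤ R) (hzR : (Γ.dist x z : ℝ) + 4 * j ≤ R) :
    Γ.green (Γ.ball x R) x y ≤ H ^ (80 + N) * Γ.green (Γ.ball x R) x z := by
  have hD := h.finite_ball x R
  set D := Γ.ball x R with hDdef
  have hj' : (0 : ℝ) < j := by exact_mod_cast hj
  have hH0 : 0 ≤ H := zero_le_one.trans hH1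
  obtain ⟨γ₁, h10, h1y, -, h1d, h1x⟩ := Γ.exists_geodesic x y
  obtain ⟨γ₂, h20, h2z, -, h2d, h2x⟩ := Γ.exists_geodesic x z
  rw [hy] at h1y h1x
  have hsub : ∀ c, ∀ r : ℝ, (Γ.dist x c : ℝ) + r ≤ R → Γ.ball c r ⊆ D := by
    intro c r hc b hb
    have h1 : (Γ.dist x b : ℝ) ≤ Γ.dist x c + Γ.dist c b := by
      exact_mod_cast Γ.dist_triangle x c b
    have h2 : (Γ.dist c b : ℝ) < r := hb
    rw [hDdef, mem_ball]
    linarith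
  have hsub1 : ∀ t ≤ 64 * j, Γ.ball (γ₁ t) (4 * j) ⊆ D := by
    intro t ht
    refine hsub _ _ ?_
    rw [h1x t ht]
    have : (t : ℝ) ≤ 64 * j := by exact_mod_cast ht
    linarith
  have hsub2 : ∀ t ≤ Γ.dist x z, Γ.ball (γ₂ t) (4 * j) ⊆ D := by
    intro t ht
    refine hsub _ _ ?_
    rw [h2x t ht]
    have : (t : ℝ) ≤ Γ.dist x z := by exact_mod_cast ht
    linarith
  have hnot : ∀ c p : V, 4 * j ≤ Γ.dist c p → p ∉ Γ.ball c (4 * j) := by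
    intro c p hcp hp
    rw [mem_ball] at hp
    have : (4 * j : ℝ) ≤ Γ.dist c p := by exact_mod_cast hcp
    linarith
  have hxD : x ∈ D := mem_ball_self Γ (by linarith)
  have hyD : y ∈ D := by
    rw [hDdef, mem_ball, hy]; push_cast; linarith
  -- An auxiliary pole on the way to `z`, far from `x` and, as `y` is at distance `64 j`, also far
  -- from `y`.
  set p := γ₂ (16 * j) with hp
  have hpx : Γ.dist x p = 16 * j := h2x _ hz1
  have hpD : p ∈ D := by
    rw [hDdef, mem_ball, hpx]; push_cast; linarith
  have hnn := fun a b => h.green_nonneg hD a b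
  -- along the second geodesic, away from the pole `x`
  have hpz : Γ.green D x p ≤ H ^ N * Γ.green D x z := by
    have := (hH.chain hH1 (hnn x) h2d hj (s := 16 * j) (e := Γ.dist x z)
      (fun t hst hte => h.harmonicOn_green hD (hsub2 t hte) (hnot _ _ (by
        rw [dist_comm, h2x t hte]; omega))) N (16 * j) (Γ.dist x z) le_rfl hz1 le_rfl
      (by omega)).1
    rwa [h2z] at this
  -- If the geodesic to `y` passes close to `p`, the chain from `y` to that place, across to `p` and
  -- on to `z` stays away from `x`.
  by_cases hcase : ∃ t ≤ 64 * j, Γ.dist (γ₁ t) p < 4 * j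
  · obtain ⟨t, ht, htp⟩ := hcase
    have htx := h1x t ht
    have h12 : 12 * j ≤ t := by
      have := Γ.dist_triangle x (γ₁ t) p
      omega
    have h1 : Γ.green D x y ≤ H ^ 64 * Γ.green D x (γ₁ t) := by
      have := (hH.chain hH1 (hnn x) h1d hj (s := t) (e := 64 * j)
        (fun i hti hi => h.harmonicOn_green hD (hsub1 i hi) (hnot _ _ (by
          rw [dist_comm, h1x i hi]; omega))) 64 t (64 * j) le_rfl ht le_rfl (by omega)).2
      rwa [h1y] at this
    have h2 : Γ.green D x (γ₁ t) ≤ H * Γ.green D x p := by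
      refine hH p (4 * j) (by linarith) _ (hnn x) (h.harmonicOn_green hD ?_ ?_) _ ?_ _
        (mem_ball_self Γ (by linarith))
      · refine hsub _ _ ?_
        rw [hpx]; push_cast; linarith
      · rw [mem_ball, dist_comm, hpx]; push_cast; linarith
      · rw [mem_ball, dist_comm]; exact_mod_cast htp
    calc Γ.green D x y ≤ H ^ 64 * (H * (H ^ N * Γ.green D x z)) := by
          refine h1.trans ?_
          gcongr
          refine h2.trans ?_
          gcongr
      _ = H ^ (65 + N) * Γ.green D x z := by ring
      _ ≤ H ^ (80 + N) * Γ.green D x z := by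
          exact mul_le_mul_of_nonneg_right (pow_le_pow_right₀ hH1 (by omega)) (hnn x z)
  -- Otherwise `p` can serve as a pole: move `x` to `p` with pole `y` fixed, then, by symmetry, move
  -- `y` to `x` with pole `p` fixed. The powers 16, 64 and `N` add up to the exponent.
  · push Not at hcase
    have h1 : Γ.green D y x ≤ H ^ 16 * Γ.green D y p := by
      have := (hH.chain hH1 (hnn y) h2d hj (s := 0) (e := 16 * j)
        (fun t _ ht => h.harmonicOn_green hD (hsub2 t (ht.trans hz1)) (hnot _ _ (by
          have h3 := Γ.dist_triangle x (γ₂ t) y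
          rw [h2x t (ht.trans hz1), hy] at h3
          omega))) 16 0 (16 * j) le_rfl (Nat.zero_le _) le_rfl (by omega)).1
      rwa [h20] at this
    have h2 : Γ.green D p y ≤ H ^ 64 * Γ.green D p x := by
      have := (hH.chain hH1 (hnn p) h1d hj (s := 0) (e := 64 * j)
        (fun t _ ht => h.harmonicOn_green hD (hsub1 t ht) (hnot _ _ (hcase t ht)))
        64 0 (64 * j) le_rfl (Nat.zero_le _) le_rfl (by omega)).2
      rwa [h10, h1y] at this
    rw [h.green_comm hD hyD hxD, h.green_comm hD hyD hpD] at h1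
    rw [h.green_comm hD hpD hxD] at h2
    calc Γ.green D x y ≤ H ^ 16 * (H ^ 64 * (H ^ N * Γ.green D x z)) := by
          refine h1.trans ?_
          gcongr
          refine h2.trans ?_
          gcongr
      _ = H ^ (80 + N) * Γ.green D x z := by ring

/-- The trivial Harnack inequality along a geodesic from the centre of a ball. -/
theorem LocallyFinite.pow_mul_le [Nontrivial V] (h : Γ.LocallyFinite) {p : ℝ} (hp : 0 < p)
    (hP : ∀ x y, 0 < Γ.w x y → p ≤ Γ.P x y) {x : V} {R : ℝ} {u : V → ℝ} (hu : ∀ y, 0 ≤ u y)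
    (hsup : ∀ y ∈ Γ.ball x R, Γ.markov u y ≤ u y) {z : V} (hz : z ∈ Γ.ball x R) :
    p ^ Γ.dist x z * u x ≤ u z ∧ p ^ Γ.dist x z * u z ≤ u x := by
  -- A single term of `P u` is kept. Only superharmonicity is needed, so for a Green function the
  -- pole is no obstacle.
  have hstep : ∀ a ∈ Γ.ball x R, ∀ b, 0 < Γ.w a b → p * u b ≤ u a := by
    intro a ha b hab
    calc p * u b ≤ Γ.P a b * u b := mul_le_mul_of_nonneg_right (hP a b hab) (hu b)
      _ ≤ Γ.markov u a := (h.summable_P u a).le_tsum b fun c _ => mul_nonneg (P_nonneg a c) (hu c)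
      _ ≤ u a := hsup a ha
  obtain ⟨γ, h0, h1, hw, -, hd⟩ := Γ.exists_geodesic x z
  have hball : ∀ t ≤ Γ.dist x z, γ t ∈ Γ.ball x R := by
    intro t ht
    have : (t : ℝ) ≤ Γ.dist x z := by exact_mod_cast ht
    rw [mem_ball, hd t ht]
    exact this.trans_lt hz
  have key : ∀ t ≤ Γ.dist x z, p ^ t * u x ≤ u (γ t) ∧ p ^ t * u (γ t) ≤ u x := by
    intro t
    induction t with
    | zero => intro _; simp [h0]
    | succ t ih =>
      intro ht
      obtain ⟨i1, i2⟩ := ih (by omega)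
      have hwt := hw t (by omega)
      have e1 := hstep _ (hball (t + 1) ht) (γ t) (by rwa [Γ.symm])
      have e2 := hstep _ (hball t (by omega)) (γ (t + 1)) hwt
      constructor
      · calc p ^ (t + 1) * u x = p * (p ^ t * u x) := by ring
          _ ≤ p * u (γ t) := by gcongr
          _ ≤ _ := e1
      · calc p ^ (t + 1) * u (γ (t + 1)) = p ^ t * (p * u (γ (t + 1))) := by ring
          _ ≤ p ^ t * u (γ t) := by gcongr
          _ ≤ _ := i2
  have := key _ le_rfl
  rwa [h1] at this

theorem CondP0.exists_le_one {Γ : WeightedGraph V} (h : Γ.CondP0) :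
    ∃ p : ℝ, 0 < p ∧ p ≤ 1 ∧ ∀ x y, 0 < Γ.w x y → p ≤ Γ.P x y := by
  obtain ⟨p, hp, hP⟩ := h
  exact ⟨min p 1, lt_min hp one_pos, min_le_right _ _,
    fun x y hxy => (min_le_left _ _).trans (hP x y hxy)⟩

theorem CondP0.green_pos [Infinite V] (hp0 : Γ.CondP0) {x z : V} {R : ℝ} (hR : 0 < R)
    (hz : z ∈ Γ.ball x R) : 0 < Γ.green (Γ.ball x R) x z := by
  have h := hp0.locallyFinite
  have hD := h.finite_ball x R
  obtain ⟨p, hp, -, hP⟩ := hp0.exists_le_one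
  have := (h.pow_mul_le hp hP (h.green_nonneg hD x)
    (fun y hy => h.markov_green_le hD x hy) hz).1
  have hx := h.green_self_pos hD (mem_ball_self Γ (x := x) hR)
  exact (mul_pos (pow_pos hp _) hx).trans_le this

/-- The Harnack inequality for the Green function on bounded scales. -/
theorem CondP0.green_le_of_bounded [Infinite V] (hp0 : Γ.CondP0) (K : ℕ) :
    ∃ C : ℝ, 0 < C ∧ ∀ (x : V) (R : ℝ), R ≤ K → ∀ y, ∀ z ∈ Γ.ball x R,
      Γ.green (Γ.ball x R) x y ≤ C * Γ.green (Γ.ball x R) x z := by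
  have h := hp0.locallyFinite
  obtain ⟨p, hp, hp1, hP⟩ := hp0.exists_le_one
  -- The comparison goes through the centre, at a cost of one factor on each side.
  refine ⟨(p ^ K)⁻¹ * (p ^ K)⁻¹, by positivity, fun x R hR y z hz => ?_⟩
  have hD := h.finite_ball x R
  have hnn := h.green_nonneg hD x
  by_cases hy : y ∈ Γ.ball x R
  · have key := fun {z : V} (hz : z ∈ Γ.ball x R) => h.pow_mul_le hp hP hnn
      (fun y hy => h.markov_green_le hD x hy) hz
    have hpow : ∀ {z : V}, z ∈ Γ.ball x R → p ^ K ≤ p ^ Γ.dist x z := fun {z} hz =>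
      pow_le_pow_of_le_one hp.le hp1 (by
        have : (Γ.dist x z : ℝ) ≤ K := (le_of_lt hz).trans hR
        exact_mod_cast this)
    have h1 : p ^ K * Γ.green (Γ.ball x R) x y ≤ Γ.green (Γ.ball x R) x x :=
      (mul_le_mul_of_nonneg_right (hpow hy) (hnn y)).trans (key hy).2
    have h2 : p ^ K * Γ.green (Γ.ball x R) x x ≤ Γ.green (Γ.ball x R) x z :=
      (mul_le_mul_of_nonneg_right (hpow hz) (hnn x)).trans (key hz).1
    have hpK : 0 < p ^ K := pow_pos hp _
    rw [← le_div_iff₀' hpK, div_eq_inv_mul] at h1 h2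
    calc Γ.green (Γ.ball x R) x y ≤ (p ^ K)⁻¹ * Γ.green (Γ.ball x R) x x := h1
      _ ≤ (p ^ K)⁻¹ * ((p ^ K)⁻¹ * Γ.green (Γ.ball x R) x z) := by gcongr
      _ = _ := by ring
  · rw [h.green_eq_zero hD x hy]
    have := hnn z
    positivity

/-- The Harnack inequality for the Green function of a ball, in terms of the distance from the
pole at the centre. -/
theorem CondP0.green_harnack [Infinite V] (hp0 : Γ.CondP0) (hH : Γ.EllipticHarnack) {ε : ℝ}
    (hε : 0 < ε) (hε1 : ε ≤ 1) :
    ∃ C : ℝ, 0 < C ∧ ∀ (x : V) (R : ℝ), 1 / 2 < R → ∀ y, ε * R ≤ Γ.dist x y + 1 →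
      ∀ z ∈ Γ.ball x R,
        Γ.green (Γ.ball x (2 * R)) x y ≤ C * Γ.green (Γ.ball x (2 * R)) x z := by
  have h := hp0.locallyFinite
  obtain ⟨H, hH1, hH⟩ := hH
  replace hH : Γ.HarnackWith H := hH
  -- Beyond this scale `ε R ≥ 100`, which leaves room for rounding in the choice of `j`; smaller
  -- scales are handled by `(p₀)` alone. The choice of `N` gives `2R ≤ N j`.
  obtain ⟨K, hK⟩ := exists_nat_gt (200 / ε)
  obtain ⟨N, hN⟩ := exists_nat_gt (400 / ε)
  obtain ⟨C₀, hC₀, hsmall⟩ := hp0.green_le_of_bounded K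
  have hH0 : 0 < H := one_pos.trans hH1
  refine ⟨max C₀ (H ^ (80 + N)), lt_max_of_lt_left hC₀, fun x R hR y hy z hz => ?_⟩
  have hD := h.finite_ball x (2 * R)
  have hnn := h.green_nonneg hD x
  rcases le_or_gt (2 * R) K with hRK | hRK
  · refine (hsmall x (2 * R) hRK y z (ball_mono Γ x (by linarith) hz)).trans ?_
    exact mul_le_mul_of_nonneg_right (le_max_left _ _) (hnn z)
  refine le_trans ?_ (mul_le_mul_of_nonneg_right (le_max_right _ _) (hnn z))
  set C := H ^ (80 + N) with hC
  have hCpos : 0 < C := pow_pos hH0 _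
  have hεR : 100 ≤ ε * R := by
    have h1 : 200 / ε < 2 * R := hK.trans hRK
    rw [div_lt_iff₀ hε] at h1
    linarith
  have hR100 : 100 ≤ R := hεR.trans (by nlinarith)
  have hεR1 : ε * R ≤ R := by nlinarith
  -- Chosen so that `64 j ≤ ε R - 1 ≤ d(x, y)`, while `j` remains comparable to `R`.
  set j := ⌊(ε * R - 1) / 64⌋₊ with hj
  have hj1 : (j : ℝ) ≤ (ε * R - 1) / 64 := Nat.floor_le (by linarith)
  have hj2 : (ε * R - 1) / 64 < j + 1 := Nat.lt_floor_add_one _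
  have hjR : ε * R / 200 ≤ j := by linarith
  have hjpos : 0 < j := by
    have : (0 : ℝ) < j := by linarith
    exact_mod_cast this
  have hNj : 2 * R ≤ N * j := by
    have h1 : 400 ≤ N * ε := by rw [div_lt_iff₀ hε] at hN; exact hN.le
    have h2 : (N : ℝ) * (ε * R / 200) ≤ N * j := by gcongr
    nlinarith
  have hsphere : ∀ a, Γ.dist x a = 64 * j → ∀ b, R ≤ Γ.dist x b → (Γ.dist x b : ℝ) ≤ R + 1 →
      Γ.green (Γ.ball x (2 * R)) x a ≤ C * Γ.green (Γ.ball x (2 * R)) x b := by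
    intro a ha b hb1 hb2
    refine hH.green_le hH1.le h hjpos ha ?_ ?_ (by linarith) (by linarith)
    · have : (16 * j : ℝ) ≤ Γ.dist x b := by linarith
      exact_mod_cast this
    · have : (Γ.dist x b : ℝ) ≤ N * j := by linarith
      exact_mod_cast this
  -- The Green function is harmonic beyond the sphere of radius `64 j` and vanishes outside the big
  -- ball, so the bound on that sphere propagates outwards.
  have houter : ∀ a, 64 * j ≤ Γ.dist x a → ∀ b, R ≤ Γ.dist x b → (Γ.dist x b : ℝ) ≤ R + 1 →
      Γ.green (Γ.ball x (2 * R)) x a ≤ C * Γ.green (Γ.ball x (2 * R)) x b := by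
    intro a ha b hb1 hb2
    have hrhs : 0 ≤ C * Γ.green (Γ.ball x (2 * R)) x b := mul_nonneg hCpos.le (hnn b)
    by_cases haD : a ∈ Γ.ball x (2 * R)
    swap
    · rw [h.green_eq_zero hD x haD]; exact hrhs
    rcases ha.eq_or_lt with ha' | ha'
    · exact hsphere a ha'.symm b hb1 hb2
    set u : V → ℝ := fun c => if 64 * j ≤ Γ.dist x c then Γ.green (Γ.ball x (2 * R)) x c else 0
      with hu
    have hmax := h.max_principle (D := {c | c ∈ Γ.ball x (2 * R) ∧ 64 * j < Γ.dist x c})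
      (hD.subset fun c hc => hc.1) (u := u) (c := C * Γ.green (Γ.ball x (2 * R)) x b) ?_ ?_ a
      ⟨haD, ha'⟩
    · rw [hu] at hmax; simp only at hmax; rwa [if_pos ha] at hmax
    · rintro c ⟨hcD, hc⟩
      have h1 : Γ.markov u c = Γ.markov (Γ.green (Γ.ball x (2 * R)) x) c := by
        refine markov_congr fun d hd => ?_
        have := Γ.dist_le_succ (x := x) (y := d) (z := c) (by rwa [Γ.symm])
        rw [hu]; simp only; rw [if_pos (by omega)]
      have hcx : c ≠ x := by
        rintro rfl
        rw [dist_self] at hc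
        omega
      rw [h1, h.markov_green hD hcD hcx, hu]
      simp only
      rw [if_pos hc.le]
    · rintro c ⟨hcD, hc⟩ d hd hcd
      have := Γ.dist_le_succ (x := x) (y := d) (z := c) (by rwa [Γ.symm])
      have hd64 : 64 * j ≤ Γ.dist x d := by omega
      rw [hu]; simp only; rw [if_pos hd64]
      by_cases hdD : d ∈ Γ.ball x (2 * R)
      · have : ¬ 64 * j < Γ.dist x d := fun hlt => hd ⟨hdD, hlt⟩
        exact hsphere d (by omega) b hb1 hb2
      · rw [h.green_eq_zero hD x hdD]; exact hrhs
  have hy64 : 64 * j ≤ Γ.dist x y := by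
    have : (64 * j : ℝ) ≤ Γ.dist x y := by linarith
    exact_mod_cast this
  -- Superharmonicity, valid at the pole too, carries the lower bound from the outer boundary of
  -- `B(x, R)` to its inside.
  have hmin := h.min_principle (h.finite_ball x R) (u := Γ.green (Γ.ball x (2 * R)) x)
    (c := C⁻¹ * Γ.green (Γ.ball x (2 * R)) x y)
    (fun a ha => h.markov_green_le hD x (ball_mono Γ x (by linarith) ha)) ?_ z hz
  · rwa [inv_mul_le_iff₀ hCpos] at hmin
  · intro a ha b hb hab
    have h1 : (Γ.dist x b : ℝ) ≤ Γ.dist x a + 1 := by exact_mod_cast Γ.dist_le_succ (x := x) hab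
    have h2 : (Γ.dist x a : ℝ) < R := ha
    rw [inv_mul_le_iff₀ hCpos]
    exact houter y hy64 b (not_lt.1 hb) (by linarith)

end Harnack

/-! ### The exit time as a sum of survival indicators. -/

section ExitTime

variable {V : Type*}

open Classical in
/-- The indicator of the event that the path stays in `D` up to time `n`. -/
noncomputable def stays (D : Set V) (n : ℕ) (X : ℕ → V) : ℝ≥0∞ :=
  ∏ k ∈ Finset.range (n + 1), D.indicator (fun _ => 1) (X k)

open Classical in
theorem stays_eq (D : Set V) (n : ℕ) (X : ℕ → V) :
    stays D n X = if ∀ k ≤ n, X k ∈ D then 1 else 0 := by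
  rw [stays]
  split_ifs with h
  · exact Finset.prod_eq_one fun k hk =>
      Set.indicator_of_mem (h k (Nat.lt_succ_iff.1 (Finset.mem_range.1 hk))) _
  · push Not at h
    obtain ⟨k, hk, hX⟩ := h
    exact Finset.prod_eq_zero (Finset.mem_range.2 (Nat.lt_succ_of_le hk))
      (Set.indicator_of_notMem hX _)

theorem stays_succ (D : Set V) (n : ℕ) (X : ℕ → V) :
    stays D (n + 1) X = stays D n X * D.indicator (fun _ => 1) (X (n + 1)) := by
  rw [stays, Finset.prod_range_succ, stays]

theorem exitTime_eq_tsum (D : Set V) (X : ℕ → V) : exitTime D X = ∑' n, stays D n X := by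
  classical
  by_cases h : ∃ k, X k ∉ D
  · have hmin : exitTime D X = (Nat.find h : ℝ≥0∞) := by
      refine le_antisymm (iInf₂_le (Nat.find h) (Nat.find_spec h)) (le_iInf₂ fun k hk => ?_)
      exact_mod_cast Nat.find_min' h hk
    have hst : ∀ n, stays D n X = if n < Nat.find h then 1 else 0 := by
      intro n
      rw [stays_eq]
      congr 1
      rw [eq_iff_iff, Nat.lt_find_iff]
      simp
    rw [hmin, tsum_eq_sum (s := Finset.range (Nat.find h))
      (fun n hn => by rw [hst, if_neg (by simpa using hn)]),
      Finset.sum_congr rfl fun n hn => by rw [hst, if_pos (Finset.mem_range.1 hn)]]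
    simp
  · push Not at h
    have hst : ∀ n, stays D n X = 1 := fun n => by rw [stays_eq, if_pos fun k _ => h k]
    simp only [hst, exitTime, h, not_true_eq_false, iInf_false, iInf_const]
    exact (ENNReal.tsum_const_eq_top_of_ne_zero one_ne_zero).symm

end ExitTime

/-! ### The Markov property and the mean exit time as a Green integral. -/

section Walk

variable {V : Type*} [MeasurableSpace V] [DiscreteMeasurableSpace V] [Countable V]
  {Γ : WeightedGraph V} {D : Set V}

theorem lintegral_stepPMF [Nontrivial V] (y : V) (f : V → ℝ≥0∞) :
    ∫⁻ z, f z ∂(Γ.stepPMF y).toMeasure = ∑' z, ENNReal.ofReal (Γ.P y z) * f z := by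
  rw [lintegral_countable']
  refine tsum_congr fun z => ?_
  rw [PMF.toMeasure_apply_singleton _ _ (measurableSet_singleton z), mul_comm]
  rfl

instance [Nontrivial V] (x : V) : IsProbabilityMeasure (Γ.walkLaw x) := by
  unfold walkLaw; infer_instance

/-- The Markov property at time `n`. -/
theorem lintegral_walkLaw_succ [Nontrivial V] (x : V) (n : ℕ)
    {φ : (Finset.Iic n → V) → ℝ≥0∞} (hφ : Measurable φ) (f : V → ℝ≥0∞) :
    ∫⁻ X, φ (Preorder.frestrictLe n X) * f (X (n + 1)) ∂(Γ.walkLaw x) =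
      ∫⁻ X, φ (Preorder.frestrictLe n X) * (∑' z, ENNReal.ofReal (Γ.P (X n) z) * f z)
        ∂(Γ.walkLaw x) := by
  have hf : Measurable f := measurable_of_countable f
  have hrest : Measurable (Preorder.frestrictLe (π := fun _ : ℕ => V) n) :=
    Preorder.measurable_frestrictLe n
  -- The joint law of the history and the next position is the law of the history composed with the
  -- step kernel.
  have key := Kernel.map_frestrictLe_trajMeasure_compProd_eq_map_trajMeasure
    (X := fun _ => V) (μ₀ := Measure.dirac x) (κ := Γ.stepKernel) (a := n)
  have h1 : ∫⁻ p, φ p.1 * f p.2 ∂((Γ.walkLaw x).map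
      (fun X => (Preorder.frestrictLe (π := fun _ : ℕ => V) n X, X (n + 1)))) =
      ∫⁻ X, φ (Preorder.frestrictLe n X) * f (X (n + 1)) ∂(Γ.walkLaw x) := by
    rw [lintegral_map (by fun_prop) (by fun_prop)]
  rw [← h1, walkLaw, ← key, Measure.lintegral_compProd (by fun_prop),
    lintegral_map (Measurable.lintegral_kernel_prod_right (by fun_prop)) hrest]
  refine lintegral_congr fun X => ?_
  dsimp only
  rw [lintegral_const_mul _ hf]
  congr 1
  exact lintegral_stepPMF _ _

theorem lintegral_walkLaw_zero [Nontrivial V] (x : V) (f : V → ℝ≥0∞) :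
    ∫⁻ X, f (X 0) ∂(Γ.walkLaw x) = f x := by
  have hf : Measurable f := measurable_of_countable f
  have hrest : Measurable (Preorder.frestrictLe (π := fun _ : ℕ => V) 0) :=
    Preorder.measurable_frestrictLe 0
  have h1 : ∫⁻ X, f (X 0) ∂(Γ.walkLaw x) =
      ∫⁻ p, f (p ⟨0, Finset.mem_Iic.2 le_rfl⟩) ∂((Γ.walkLaw x).map
        (Preorder.frestrictLe (π := fun _ : ℕ => V) 0)) := by
    rw [lintegral_map (by fun_prop) hrest]
    rfl
  rw [h1, walkLaw, Kernel.trajMeasure, Measure.map_comp _ _ (by fun_prop),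
    Kernel.traj_map_frestrictLe, Kernel.partialTraj_self, Measure.id_comp,
    lintegral_map (by fun_prop) (by fun_prop), lintegral_dirac' _ (by fun_prop)]
  rfl

theorem measurable_stays (D : Set V) (n : ℕ) : Measurable (stays D n) := by
  unfold stays
  refine Finset.measurable_prod _ fun k _ => ?_
  exact (measurable_of_countable (D.indicator fun _ => (1 : ℝ≥0∞))).comp (measurable_pi_apply k)

/-- A nonnegative solution of `e = 1 + P e` in a finite set `D`, zero outside, is the mean exit
time. -/
theorem meanExit_eq [Nontrivial V] (hD : D.Finite) {e : V → ℝ≥0∞} (he : ∀ y ∉ D, e y = 0)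
    (hfin : ∀ y, e y ≠ ⊤)
    (hsol : ∀ y ∈ D, e y = 1 + ∑' z, ENNReal.ofReal (Γ.P y z) * e z) (x : V) :
    Γ.meanExit x D = e x := by
  classical
  set a : ℕ → ℝ≥0∞ := fun n => ∫⁻ X, stays D n X ∂(Γ.walkLaw x) with ha
  set b : ℕ → ℝ≥0∞ := fun n => ∫⁻ X, stays D n X * e (X n) ∂(Γ.walkLaw x) with hb
  have hexit : Γ.meanExit x D = ∑' n, a n := by
    rw [meanExit, ← lintegral_tsum fun n => (measurable_stays D n).aemeasurable]
    exact lintegral_congr fun X => exitTime_eq_tsum D X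
  have hb0 : b 0 = e x := by
    have : b 0 = ∫⁻ X, (fun y => D.indicator (fun _ => 1) y * e y) (X 0) ∂(Γ.walkLaw x) := by
      refine lintegral_congr fun X => ?_
      simp [stays]
    rw [this, lintegral_walkLaw_zero x fun y => D.indicator (fun _ => 1) y * e y]
    by_cases hx : x ∈ D
    · simp [hx]
    · simp [hx, he x hx]
  -- The equation for `e` and the Markov property. Telescoping bounds the sum of the survival
  -- probabilities `a n` by `e x < ∞`, hence `a n → 0`, and the remainder `b n ≤ M a n` vanishes in
  -- the limit.
  have hstep : ∀ n, b n = a n + b (n + 1) := by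
    intro n
    have hφ : Measurable fun h : Finset.Iic n → V =>
        ∏ k : Finset.Iic n, D.indicator (fun _ => (1 : ℝ≥0∞)) (h k) := by
      refine Finset.measurable_prod _ fun k _ => ?_
      exact (measurable_of_countable (D.indicator fun _ => (1 : ℝ≥0∞))).comp
        (measurable_pi_apply k)
    have hst : ∀ X : ℕ → V, stays D n X = ∏ k : Finset.Iic n,
        D.indicator (fun _ => (1 : ℝ≥0∞)) (Preorder.frestrictLe n X k) := by
      intro X
      rw [stays]
      have : Finset.range (n + 1) = Finset.Iic n := by ext; simp
      rw [this]
      exact (Finset.prod_coe_sort (Finset.Iic n)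
        fun k => D.indicator (fun _ => (1 : ℝ≥0∞)) (X k)).symm
    have h1 : b (n + 1) = ∫⁻ X, stays D n X *
        (∑' z, ENNReal.ofReal (Γ.P (X n) z) * e z) ∂(Γ.walkLaw x) := by
      have := lintegral_walkLaw_succ (Γ := Γ) x n hφ e
      simp only [← hst] at this
      rw [← this]
      refine lintegral_congr fun X => ?_
      rw [stays_succ]
      by_cases hX : X (n + 1) ∈ D
      · simp [hX]
      · simp [hX, he _ hX]
    rw [h1, ha, ← lintegral_add_left (measurable_stays D n)]
    refine lintegral_congr fun X => ?_
    by_cases hX : X n ∈ D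
    · rw [hsol _ hX]; ring
    · have : stays D n X = 0 := by
        rw [stays_eq, if_neg fun h => hX (h n le_rfl)]
      simp [this]
  have hsum : ∀ N, e x = ∑ n ∈ Finset.range N, a n + b N := by
    intro N
    induction N with
    | zero => simp [hb0]
    | succ N ih => rw [ih, hstep N, Finset.sum_range_succ, add_assoc]
  have hle : ∑' n, a n ≤ e x := by
    refine ENNReal.tsum_le_of_sum_range_le fun N => ?_
    rw [hsum N]; exact le_self_add
  obtain ⟨M, hM, hMe⟩ : ∃ M : ℝ≥0∞, M ≠ ⊤ ∧ ∀ y, e y ≤ M := by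
    refine ⟨∑ y ∈ hD.toFinset, e y, ENNReal.sum_ne_top.2 fun y _ => hfin y, fun y => ?_⟩
    by_cases hy : y ∈ D
    · exact Finset.single_le_sum (fun _ _ => zero_le) (hD.mem_toFinset.2 hy)
    · rw [he y hy]; exact zero_le
  have hbM : ∀ n, b n ≤ M * a n := by
    intro n
    rw [ha, ← lintegral_const_mul _ (measurable_stays D n)]
    refine lintegral_mono fun X => ?_
    change stays D n X * e (X n) ≤ M * stays D n X
    rw [mul_comm]
    gcongr
    exact hMe _
  have ha0 : Filter.Tendsto a Filter.atTop (nhds 0) :=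
    ENNReal.tendsto_atTop_zero_of_tsum_ne_top (ne_top_of_le_ne_top (hfin x) hle)
  have hb0' : Filter.Tendsto (fun n => M * a n) Filter.atTop (nhds 0) := by
    have := ENNReal.Tendsto.const_mul ha0 (Or.inr hM)
    rwa [mul_zero] at this
  rw [hexit]
  refine le_antisymm hle ?_
  have hlim : Filter.Tendsto (fun N => ∑ n ∈ Finset.range N, a n + M * a N) Filter.atTop
      (nhds (∑' n, a n + 0)) := (ENNReal.tendsto_nat_tsum a).add hb0'
  rw [add_zero] at hlim
  refine ge_of_tendsto' hlim fun N => ?_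
  rw [hsum N]
  gcongr
  exact hbM N

/-- The mean exit time is the integral of the Green function. -/
theorem LocallyFinite.meanExit_eq_sum [Infinite V] (h : Γ.LocallyFinite) (hD : D.Finite)
    {x : V} (hx : x ∈ D) :
    Γ.meanExit x D = ENNReal.ofReal (∑ z ∈ hD.toFinset, Γ.green D x z * Γ.mu z) := by
  -- The variable `y` sits in the second slot, where the Poisson equation acts; symmetry exchanges
  -- the slots at the end.
  set e : V → ℝ := fun y => ∑ z ∈ hD.toFinset, Γ.green D z y * Γ.mu z with hedef
  have hterm : ∀ z y, 0 ≤ Γ.green D z y * Γ.mu z := fun z y =>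
    mul_nonneg (h.green_nonneg hD z y) (Γ.mu_pos z).le
  have he0 : ∀ y, 0 ≤ e y := fun y => Finset.sum_nonneg fun z _ => hterm z y
  have hm : ∀ y ∈ D, e y = 1 + Γ.markov e y := by
    classical
    intro y hy
    have h1 : Γ.markov e y = ∑ z ∈ hD.toFinset, Γ.markov (Γ.green D z) y * Γ.mu z := by
      rw [hedef, markov_sum h]
      refine Finset.sum_congr rfl fun z _ => ?_
      rw [mul_comm, ← markov_smul]
      exact markov_congr fun a _ => by rw [Pi.smul_apply, smul_eq_mul, mul_comm]
    have h2 : e y - Γ.markov e y = 1 := by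
      rw [h1, hedef, ← Finset.sum_sub_distrib]
      rw [Finset.sum_eq_single y]
      · rw [← sub_mul, h.green_self hD hy, inv_mul_cancel₀ (Γ.mu_pos y).ne']
      · intro z _ hzy
        rw [h.markov_green hD hy hzy.symm, sub_self]
      · intro hy'
        exact absurd (hD.mem_toFinset.2 hy) hy'
    linarith
  rw [meanExit_eq hD (e := fun y => ENNReal.ofReal (e y)) ?_ (fun y => ENNReal.ofReal_ne_top) ?_]
  · congr 1
    refine Finset.sum_congr rfl fun z hz => ?_
    rw [h.green_comm hD hx (hD.mem_toFinset.1 hz)]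
  · intro y hy
    rw [hedef]
    simp only
    rw [Finset.sum_eq_zero, ENNReal.ofReal_zero]
    intro z _
    rw [h.green_eq_zero hD z hy, zero_mul]
  · intro y hy
    have hs : ∀ z, ENNReal.ofReal (Γ.P y z) * ENNReal.ofReal (e z) =
        ENNReal.ofReal (Γ.P y z * e z) := fun z => (ENNReal.ofReal_mul (P_nonneg y z)).symm
    simp only [hs]
    rw [← ENNReal.ofReal_tsum_of_nonneg (fun z => mul_nonneg (P_nonneg y z) (he0 z))
      (h.summable_P e y), hm y hy, ENNReal.ofReal_add zero_le_one
      (markov_nonneg (Γ := Γ) he0 y), ENNReal.ofReal_one]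
    rfl

end Walk

/-! ### Volumes of balls and annuli. -/

section Volume

variable {V : Type*} {Γ : WeightedGraph V} {D : Set V}

theorem vol_mono {A B : Set V} (hAB : A ⊆ B) : Γ.vol A ≤ Γ.vol B :=
  ENNReal.tsum_mono_subtype (fun y => ENNReal.ofReal (Γ.mu y)) hAB

theorem vol_eq_sum [Nontrivial V] (hD : D.Finite) :
    Γ.vol D = ENNReal.ofReal (∑ z ∈ hD.toFinset, Γ.mu z) := by
  rw [ENNReal.ofReal_sum_of_nonneg fun z _ => (Γ.mu_pos z).le, vol, ← Finset.tsum_subtype']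
  rw [Set.Finite.coe_toFinset]

theorem vol_union_of_disjoint {A B : Set V} (hAB : Disjoint A B) :
    Γ.vol (A ∪ B) = Γ.vol A + Γ.vol B :=
  ENNReal.summable.tsum_union_disjoint (f := fun y => ENNReal.ofReal (Γ.mu y)) hAB
    ENNReal.summable

theorem LocallyFinite.vol_le_annulusVol [Nontrivial V] (h : Γ.LocallyFinite) {x : V} {r R : ℝ}
    (hrR : r ≤ R) {B : Set V} (hB : B ⊆ Γ.ball x R \ Γ.ball x r) :
    Γ.vol B ≤ Γ.annulusVol x r R := by
  have hfin : Γ.ballVol x r ≠ ⊤ := by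
    rw [ballVol, vol_eq_sum (h.finite_ball x r)]; exact ENNReal.ofReal_ne_top
  refine ENNReal.le_sub_of_add_le_left hfin ?_
  rw [ballVol, ← vol_union_of_disjoint (Set.disjoint_left.2 fun y hy hyB => (hB hyB).2 hy)]
  exact vol_mono (Set.union_subset (ball_mono Γ x hrR) fun y hy => (hB hy).1)

/-- Under volume doubling, a dyadic annulus carries a fixed part of the volume of the ball. -/
theorem LocallyFinite.ballVol_le_annulusVol [Infinite V] (h : Γ.LocallyFinite) {d : ℝ}
    (hd : ∀ (x : V) (R : ℝ), 0 < R →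
      Γ.ballVol x (2 * R) ≤ ENNReal.ofReal d * Γ.ballVol x R) (x : V) {R : ℝ} (hR : 1 / 2 < R) :
    Γ.ballVol x (2 * R) ≤ ENNReal.ofReal d ^ 4 * Γ.annulusVol x R (2 * R) := by
  -- For `R ≤ 4` the small ball is the single point `y`, and `R > 1/2` ensures an integer in `[R,
  -- 2R)`. For larger `R` the distance `⌈5R/4⌉` leaves room `R/4` on both sides. Since `4R = 2⁴ ·
  -- R/4`, four doublings reach a ball containing `B(x, 2R)`.
  obtain ⟨y, hyR, hy2R, hsub⟩ : ∃ y, R ≤ Γ.dist x y ∧ (Γ.dist x y : ℝ) < 2 * R ∧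
      Γ.ball y (R / 4) ⊆ Γ.ball x (2 * R) \ Γ.ball x R := by
    rcases le_or_gt R 4 with h4 | h4
    · obtain ⟨y, hy⟩ := h.exists_dist_eq x ⌈R⌉₊
      have h1 : R ≤ Γ.dist x y := by rw [hy]; exact Nat.le_ceil R
      have h2 : (Γ.dist x y : ℝ) < 2 * R := by
        rw [hy]
        rcases le_or_gt R 1 with hR1 | hR1
        · have : ⌈R⌉₊ ≤ 1 := Nat.ceil_le.2 (by exact_mod_cast hR1)
          have : (⌈R⌉₊ : ℝ) ≤ 1 := by exact_mod_cast this
          linarith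
        · have := Nat.ceil_lt_add_one (show 0 ≤ R by linarith)
          linarith
      refine ⟨y, h1, h2, fun z hz => ?_⟩
      have hz1 : (Γ.dist y z : ℝ) < 1 := lt_of_lt_of_le hz (by linarith)
      have hz0 : Γ.dist y z = 0 := by
        have : Γ.dist y z < 1 := by exact_mod_cast hz1
        omega
      rw [← Γ.dist_eq_zero.1 hz0]
      exact ⟨h2, not_lt.2 h1⟩
    · obtain ⟨y, hy⟩ := h.exists_dist_eq x ⌈5 * R / 4⌉₊
      have h1 : 5 * R / 4 ≤ Γ.dist x y := by rw [hy]; exact Nat.le_ceil _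
      have h2 : (Γ.dist x y : ℝ) < 5 * R / 4 + 1 := by
        rw [hy]; exact Nat.ceil_lt_add_one (by linarith)
      refine ⟨y, by linarith, by linarith, fun z hz => ?_⟩
      have hz' : (Γ.dist y z : ℝ) < R / 4 := hz
      have t1 : (Γ.dist x z : ℝ) ≤ Γ.dist x y + Γ.dist y z := by
        exact_mod_cast Γ.dist_triangle x y z
      have t2 : (Γ.dist x y : ℝ) ≤ Γ.dist x z + Γ.dist y z := by
        rw [Γ.dist_comm y z]; exact_mod_cast Γ.dist_triangle x z y
      refine ⟨?_, fun hzR => ?_⟩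
      · rw [mem_ball]; linarith
      · rw [mem_ball] at hzR; linarith
  have hbig : Γ.ball x (2 * R) ⊆ Γ.ball y (4 * R) := by
    intro z hz
    have hz' : (Γ.dist x z : ℝ) < 2 * R := hz
    have t1 : (Γ.dist y z : ℝ) ≤ Γ.dist x y + Γ.dist x z := by
      rw [Γ.dist_comm x y]; exact_mod_cast Γ.dist_triangle y x z
    rw [mem_ball]; linarith
  have hdouble : ∀ n : ℕ, Γ.ballVol y (2 ^ n * (R / 4)) ≤
      ENNReal.ofReal d ^ n * Γ.ballVol y (R / 4) := by
    intro n
    induction n with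
    | zero => simp
    | succ n ih =>
      calc Γ.ballVol y (2 ^ (n + 1) * (R / 4)) = Γ.ballVol y (2 * (2 ^ n * (R / 4))) := by
            congr 1; ring
        _ ≤ ENNReal.ofReal d * Γ.ballVol y (2 ^ n * (R / 4)) :=
            hd y _ (mul_pos (by positivity) (by linarith))
        _ ≤ ENNReal.ofReal d * (ENNReal.ofReal d ^ n * Γ.ballVol y (R / 4)) := by gcongr
        _ = _ := by rw [pow_succ]; ring
  calc Γ.ballVol x (2 * R) ≤ Γ.ballVol y (4 * R) := vol_mono hbig
    _ = Γ.ballVol y (2 ^ 4 * (R / 4)) := by congr 1; ring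
    _ ≤ ENNReal.ofReal d ^ 4 * Γ.ballVol y (R / 4) := hdouble 4
    _ ≤ ENNReal.ofReal d ^ 4 * Γ.annulusVol x R (2 * R) := by
        gcongr
        exact h.vol_le_annulusVol (by linarith) hsub

end Volume

/-! ### Mean exit times from pointwise bounds of the Green function. -/

section ExitTimeBounds

variable {V : Type*} [Countable V] [Infinite V] [MeasurableSpace V] [DiscreteMeasurableSpace V]
  {Γ : WeightedGraph V} {D : Set V}

theorem LocallyFinite.mul_vol_le_meanExit (h : Γ.LocallyFinite) (hD : D.Finite) {x : V}
    (hx : x ∈ D) {B : Set V} (hB : B ⊆ D) {a : ℝ} (ha0 : 0 ≤ a)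
    (ha : ∀ z ∈ B, a ≤ Γ.green D x z) :
    ENNReal.ofReal a * Γ.vol B ≤ Γ.meanExit x D := by
  have hBf := hD.subset hB
  rw [h.meanExit_eq_sum hD hx, vol_eq_sum hBf, ← ENNReal.ofReal_mul ha0]
  refine ENNReal.ofReal_le_ofReal ?_
  rw [Finset.mul_sum]
  calc ∑ z ∈ hBf.toFinset, a * Γ.mu z ≤ ∑ z ∈ hBf.toFinset, Γ.green D x z * Γ.mu z :=
        Finset.sum_le_sum fun z hz => mul_le_mul_of_nonneg_right
          (ha z (hBf.mem_toFinset.1 hz)) (Γ.mu_pos z).le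
    _ ≤ ∑ z ∈ hD.toFinset, Γ.green D x z * Γ.mu z :=
        Finset.sum_le_sum_of_subset_of_nonneg (Set.Finite.toFinset_subset_toFinset.2 hB)
          fun z _ _ => mul_nonneg (h.green_nonneg hD x z) (Γ.mu_pos z).le

theorem LocallyFinite.meanExit_le_mul_vol (h : Γ.LocallyFinite) (hD : D.Finite) {x : V}
    (hx : x ∈ D) {b : ℝ} (hb0 : 0 ≤ b) (hb : ∀ z, Γ.green D x z ≤ b) :
    Γ.meanExit x D ≤ ENNReal.ofReal b * Γ.vol D := by
  rw [h.meanExit_eq_sum hD hx, vol_eq_sum hD, ← ENNReal.ofReal_mul hb0]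
  refine ENNReal.ofReal_le_ofReal ?_
  rw [Finset.mul_sum]
  exact Finset.sum_le_sum fun z _ => mul_le_mul_of_nonneg_right (hb z) (Γ.mu_pos z).le

theorem LocallyFinite.meanExit_le_add (h : Γ.LocallyFinite) (hD : D.Finite) {D' : Set V}
    (hD' : D' ⊆ D) {x : V} (hx : x ∈ D') {b : ℝ} (hb0 : 0 ≤ b)
    (hb : ∀ z ∉ D', Γ.green D x z ≤ b) :
    Γ.meanExit x D ≤ Γ.meanExit x D' + ENNReal.ofReal b * Γ.vol D := by
  have hD'f := hD.subset hD'
  have hnn : ∀ z, 0 ≤ Γ.green D' x z * Γ.mu z := fun z =>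
    mul_nonneg (h.green_nonneg hD'f x z) (Γ.mu_pos z).le
  rw [h.meanExit_eq_sum hD (hD' hx), h.meanExit_eq_sum hD'f hx, vol_eq_sum hD,
    ← ENNReal.ofReal_mul hb0, ← ENNReal.ofReal_add (Finset.sum_nonneg fun z _ => hnn z)
      (mul_nonneg hb0 (Finset.sum_nonneg fun z _ => (Γ.mu_pos z).le))]
  refine ENNReal.ofReal_le_ofReal ?_
  rw [Finset.sum_subset (Set.Finite.toFinset_subset_toFinset.2 hD' :
      hD'f.toFinset ⊆ hD.toFinset) fun z _ hz => by
    rw [h.green_eq_zero hD'f x fun hz' => hz (hD'f.mem_toFinset.2 hz'), zero_mul],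
    Finset.mul_sum, ← Finset.sum_add_distrib]
  refine Finset.sum_le_sum fun z _ => ?_
  rw [← add_mul]
  exact mul_le_mul_of_nonneg_right (h.green_le_green_add hD hD' hb z) (Γ.mu_pos z).le

end ExitTimeBounds

/-! ### Comparison of mean exit time with resistance times volume. -/

section Einstein

variable {V : Type*} {Γ : WeightedGraph V}

/-- The product `ρ(x, R, 2R) v(x, R, 2R)`. -/
noncomputable def resVol (Γ : WeightedGraph V) (x : V) (R : ℝ) : ℝ≥0∞ :=
  Γ.annulusRes x R (2 * R) * Γ.annulusVol x R (2 * R)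

/-- Under the Harnack inequality, the Green function of `B(x, 2R)` away from the centre is bounded
by its minimum over `B(x, R)`, which is comparable to the resistance `ρ(x, R, 2R)`. -/
theorem CondP0.exists_green_bounds [Infinite V] (hp0 : Γ.CondP0) (hH : Γ.EllipticHarnack) {ε : ℝ}
    (hε : 0 < ε) (hε1 : ε ≤ 1) :
    ∃ C : ℝ, 0 < C ∧ ∀ (x : V) (R : ℝ), 1 / 2 < R → ∃ a : ℝ, 0 < a ∧
      (∀ z ∈ Γ.ball x R, a ≤ Γ.green (Γ.ball x (2 * R)) x z) ∧
      (∀ y, ε * R ≤ Γ.dist x y + 1 → Γ.green (Γ.ball x (2 * R)) x y ≤ C * a) ∧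
      ENNReal.ofReal a ≤ Γ.annulusRes x R (2 * R) ∧
      Γ.annulusRes x R (2 * R) ≤ ENNReal.ofReal (C * a) := by
  obtain ⟨C, hC, hgreen⟩ := hp0.green_harnack hH hε hε1
  have h := hp0.locallyFinite
  refine ⟨C, hC, fun x R hR => ?_⟩
  have hR0 : 0 < R := by linarith
  have hD := h.finite_ball x (2 * R)
  have hxD : x ∈ Γ.ball x (2 * R) := mem_ball_self Γ (by linarith)
  obtain ⟨z₀, hz₀, hmin⟩ := Set.exists_min_image _ (Γ.green (Γ.ball x (2 * R)) x)
    (h.finite_ball x R) ⟨x, mem_ball_self Γ hR0⟩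
  have ha : 0 < Γ.green (Γ.ball x (2 * R)) x z₀ :=
    hp0.green_pos (by linarith) (ball_mono Γ x (by linarith) hz₀)
  refine ⟨_, ha, hmin, fun y hy => hgreen x R hR y hy z₀ hz₀, h.le_resistance hD hxD hmin,
    h.resistance_le hD hxD (mem_ball_self Γ hR0) (mul_pos hC ha) fun y hy =>
      hgreen x R hR y ?_ z₀ hz₀⟩
  -- The inner end of an edge leaving `B(x, R)` may lie one step inside, hence the `+ 1` in the
  -- Harnack bound.
  have hRy : R ≤ Γ.dist x y + 1 := by
    rcases hy with hy | ⟨z, hz, hyz⟩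
    · have : R ≤ Γ.dist x y := not_lt.1 hy
      linarith
    · have h1 : R ≤ Γ.dist x z := not_lt.1 hz
      have h2 : (Γ.dist x z : ℝ) ≤ Γ.dist x y + 1 := by
        exact_mod_cast Γ.dist_le_succ (x := x) hyz
      linarith
  nlinarith

variable [Countable V] [Infinite V] [MeasurableSpace V] [DiscreteMeasurableSpace V]

theorem CondP0.resVol_le_E (hp0 : Γ.CondP0) (hVD : Γ.VolumeDoubling) (hH : Γ.EllipticHarnack) :
    ∃ C : ℝ, 0 < C ∧ ∀ (x : V) (R : ℝ), 1 / 2 < R →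
      Γ.resVol x R ≤ ENNReal.ofReal C * Γ.E x (2 * R) := by
  obtain ⟨C, hC, hgreen⟩ := hp0.exists_green_bounds hH one_pos le_rfl
  obtain ⟨d, hd0, hd⟩ := hVD
  have h := hp0.locallyFinite
  refine ⟨C * d, mul_pos hC hd0, fun x R hR => ?_⟩
  obtain ⟨a, ha, hmin, -, -, hρ⟩ := hgreen x R hR
  have hE : ENNReal.ofReal a * Γ.ballVol x R ≤ Γ.E x (2 * R) :=
    h.mul_vol_le_meanExit (h.finite_ball x (2 * R)) (mem_ball_self Γ (by linarith))
      (ball_mono Γ x (by linarith)) ha.le hmin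
  calc Γ.resVol x R ≤ ENNReal.ofReal (C * a) * (ENNReal.ofReal d * Γ.ballVol x R) :=
        mul_le_mul' hρ (tsub_le_self.trans (hd x R (by linarith)))
    _ = ENNReal.ofReal (C * d) * (ENNReal.ofReal a * Γ.ballVol x R) := by
        rw [ENNReal.ofReal_mul hC.le, ENNReal.ofReal_mul hC.le]; ring
    _ ≤ _ := by gcongr

/-- The Harnack bound is used with `ε = 1 / A`, so that it covers everything outside the next
smaller ball `B(x, 2R/A)`. -/
theorem CondP0.E_le_resVol (hp0 : Γ.CondP0) (hVD : Γ.VolumeDoubling) (hH : Γ.EllipticHarnack)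
    (hρv : Γ.AntiDoublingResVol) :
    ∃ C : ℝ, 0 < C ∧ ∀ (x : V) (R : ℝ), 1 / 2 < R →
      Γ.E x (2 * R) ≤ ENNReal.ofReal C * Γ.resVol x R := by
  obtain ⟨A, hA, hanti⟩ := hρv
  have hA0 : 0 < A := one_pos.trans hA
  obtain ⟨C, hC, hgreen⟩ := hp0.exists_green_bounds hH (inv_pos.2 hA0) (inv_le_one_of_one_le₀ hA.le)
  obtain ⟨d, hd0, hd⟩ := hVD
  have h := hp0.locallyFinite
  set M : ℝ≥0∞ := ENNReal.ofReal (C * d ^ 4) with hM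
  have hvol : ∀ (x : V) (R a : ℝ), 1 / 2 < R → 0 < a →
      ENNReal.ofReal a ≤ Γ.annulusRes x R (2 * R) →
      ENNReal.ofReal (C * a) * Γ.vol (Γ.ball x (2 * R)) ≤ M * Γ.resVol x R := by
    intro x R a hR ha hρ
    calc ENNReal.ofReal (C * a) * Γ.vol (Γ.ball x (2 * R))
        ≤ ENNReal.ofReal (C * a) * (ENNReal.ofReal d ^ 4 * Γ.annulusVol x R (2 * R)) := by
          gcongr
          exact h.ballVol_le_annulusVol hd x hR
      _ = M * (ENNReal.ofReal a * Γ.annulusVol x R (2 * R)) := by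
          rw [hM, ENNReal.ofReal_mul hC.le, ENNReal.ofReal_mul hC.le, ENNReal.ofReal_pow hd0.le]
          ring
      _ ≤ M * Γ.resVol x R := by rw [resVol]; gcongr
  -- Here `R / A ≤ 1`, so the distance condition holds at every vertex, the pole included.
  have hsmall : ∀ (x : V) (R : ℝ), 1 / 2 < R → R ≤ A →
      Γ.E x (2 * R) ≤ M * Γ.resVol x R := by
    intro x R hR hRA
    obtain ⟨a, ha, -, hmax, hρ, -⟩ := hgreen x R hR
    refine le_trans ?_ (hvol x R a hR ha hρ)
    refine h.meanExit_le_mul_vol (h.finite_ball x (2 * R)) (mem_ball_self Γ (by linarith))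
      (mul_pos hC ha).le fun z => hmax z ?_
    have h1 : A⁻¹ * R ≤ 1 := by rwa [inv_mul_le_iff₀ hA0, mul_one]
    have h2 : (0 : ℝ) ≤ Γ.dist x z := Nat.cast_nonneg _
    linarith
  have hlarge : ∀ (x : V) (R : ℝ), A < R →
      Γ.E x (2 * R) ≤ Γ.E x (2 * (R / A)) + M * Γ.resVol x R := by
    intro x R hRA
    have hR : 1 / 2 < R := by linarith
    have hRA0 : 0 < R / A := div_pos (by linarith) hA0
    obtain ⟨a, ha, -, hmax, hρ, -⟩ := hgreen x R hR
    refine le_trans ?_ (add_le_add_right (hvol x R a hR ha hρ) _)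
    refine h.meanExit_le_add (h.finite_ball x (2 * R)) (ball_mono Γ x ?_)
      (mem_ball_self Γ (by linarith)) (mul_pos hC ha).le fun z hz => hmax z ?_
    · have := div_le_self (show 0 ≤ R by linarith) hA.le
      linarith
    · have h1 : 2 * (R / A) ≤ Γ.dist x z := not_lt.1 hz
      rw [← div_eq_inv_mul]
      linarith
  -- The constant `2M` reproduces itself: anti-doubling turns it into `M` at scale `R`, and the step
  -- from `R/A` to `R` adds another `M`.
  have hall : ∀ (n : ℕ) (x : V) (R : ℝ), 1 / 2 < R → R ≤ A ^ (n + 1) →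
      Γ.E x (2 * R) ≤ 2 * M * Γ.resVol x R := by
    intro n
    have htwo : ∀ t : ℝ≥0∞, 2 * M * t = M * t + M * t := fun t => by ring
    induction n with
    | zero =>
      intro x R hR hRA
      rw [zero_add, pow_one] at hRA
      rw [htwo]
      exact (hsmall x R hR hRA).trans le_self_add
    | succ n ih =>
      intro x R hR hRA
      rcases le_or_gt R A with hle | hlt
      · rw [htwo]
        exact (hsmall x R hR hle).trans le_self_add
      · have hRA1 : 1 < R / A := by rwa [one_lt_div hA0]
        have h1 := ih x (R / A) (by linarith) (by
          rw [div_le_iff₀ hA0, ← pow_succ]; exact hRA)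
        have h2 : 2 * Γ.resVol x (R / A) ≤ Γ.resVol x R := by
          have := hanti x (R / A) (by linarith)
          rwa [mul_div_cancel₀ R hA0.ne'] at this
        calc Γ.E x (2 * R) ≤ Γ.E x (2 * (R / A)) + M * Γ.resVol x R := hlarge x R hlt
          _ ≤ M * Γ.resVol x R + M * Γ.resVol x R := by
              gcongr
              calc Γ.E x (2 * (R / A)) ≤ 2 * M * Γ.resVol x (R / A) := h1
                _ = M * (2 * Γ.resVol x (R / A)) := by ring
                _ ≤ M * Γ.resVol x R := by gcongr
          _ = 2 * M * Γ.resVol x R := (htwo _).symm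
  refine ⟨2 * (C * d ^ 4), by positivity, fun x R hR => ?_⟩
  obtain ⟨n, hn⟩ := pow_unbounded_of_one_lt R hA
  have := hall n x R hR (hn.le.trans (pow_le_pow_right₀ hA.le n.le_succ))
  rwa [ENNReal.ofReal_mul zero_le_two, ENNReal.ofReal_ofNat]

end Einstein

end WeightedGraph

theorem mainTheorem4 {V : Type*} [Countable V] [Infinite V]
    [MeasurableSpace V] [DiscreteMeasurableSpace V] (Γ : WeightedGraph V)
    (hp0 : Γ.CondP0) (hVD : Γ.VolumeDoubling) (hH : Γ.EllipticHarnack)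
    (hρv : Γ.AntiDoublingResVol) :
    ∃ C : ℝ, 1 < C ∧ ∀ (x : V) (R : ℝ), 1 / 2 < R →
      (ENNReal.ofReal C)⁻¹ * Γ.E x (2 * R) ≤
          Γ.annulusRes x R (2 * R) * Γ.annulusVol x R (2 * R) ∧
        Γ.annulusRes x R (2 * R) * Γ.annulusVol x R (2 * R) ≤
          ENNReal.ofReal C * Γ.E x (2 * R) := by
  obtain ⟨C₁, hC₁, h₁⟩ := hp0.resVol_le_E hVD hH
  obtain ⟨C₂, hC₂, h₂⟩ := hp0.E_le_resVol hVD hH hρv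
  refine ⟨C₁ + C₂ + 1, by linarith, fun x R hR => ⟨?_, ?_⟩⟩
  · rw [ENNReal.inv_mul_le_iff (by simpa using by linarith) ENNReal.ofReal_ne_top]
    refine (h₂ x R hR).trans ?_
    rw [WeightedGraph.resVol]
    gcongr
    linarith
  · refine (h₁ x R hR).trans ?_
    gcongr
    linarith
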